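/- **Suboptimality of training-based schemes.** *Channel.* Let $Q(y|x)$ be a discrete memoryless channel with finite alphabets $\mathcal X,\mathcal Y$ such that every $y\in\mathcal Y$ satisfies $Q(y|x)>0$ for some $x$. Let $\star\in\mathcal X$ be a designated "no-input" symbol and $Q_\star=Q(\cdot|\star)$. Let $C=\max_P I(PQ)$ be the capacity of the synchronous channel in nats, where $I(PQ)$ is the input-output mutual information for the input distribution $P$, and let $\alpha_\circ=\max_x D(Q(\cdot|x)\,\|\,Q_\star)\in[0,\infty]$. *Codes.* A code of block length $n$ at asynchronism level $A\ge 1$ (an integer) has $M\ge 2$ messages with codewords $c^n(m)\in\mathcal X^n$. Given that message $m$ starts being sent at time $t\in\{1,\dots,A\}$, the receiver observes independent outputs $Y_1,\dots,Y_{A+n-1}$, where $Y_i\sim Q(\cdot|c_{i-t+1}(m))$ for $t\le i\le t+n-1$ and $Y_i\sim Q_\star$ otherwise; write $\mathbb P_{m,t},\mathbb E_{m,t}$ for probability and expectation. The decoder consists of a possibly randomized stopping time $\tau\le A+n-1$ with respect to $Y_1,Y_2,\dots$ and of a decision $\phi(Y^\tau)$, a function of the outputs observed up to $\tau$. The maximum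 error probability, the delay and the rate of the code are $$\max_m\frac1A\sum_{t=1}^A\mathbb P_{m,t}(\phi(Y^\tau)\ne m),\qquad \Delta=\max_m\frac1A\sum_{t=1}^A\mathbb E_{m,t}(\tau-t)^+,\qquad \frac{\ln M}{\Delta}\ \ (=\infty\text{ if }\Delta=0).$$ *Capacities.* A coding scheme is a sequence of codes, the $n$-th one having block length $n$ and asynchronism level $A_n$. It achieves $(R,\alpha)$, $\alpha\ge0$, if for every $\epsilon>0$ and all large $n$ we have $e^{(\alpha-\epsilon)n}\le A_n\le e^{(\alpha+\epsilon)n}$, the rate of the $n$-th code is at least $R-\epsilon$, and its maximum error probability is at most $\epsilon$. The scheme is training-based if for some $\eta\in[0,1]$ and all large $n$ all codewords of the $n$-th code start with the same $\lfloor\eta n\rfloor$ symbols, and the decision to stop at time $t$, if the decoder has not stopped before, is a function of the outputs among $Y_1,\dots,Y_{A_n+n-1}$ whose time lies in $\{t-n+1,\dots,t-n+\lfloor\eta n\rfloor\}$ and of a random seed that is independent of the message, of its starting time and of the outputs. Let $\alpha(R)$ and $\alpha^{\mathrm T}(R)$ be the suprema in $[0,\infty]$ of the exponents $\alpha$ such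 that $(R,\alpha)$ is achieved by some coding scheme, respectively by some training-based scheme. **Corollary 4.** Suppose that $Q_\star$ is not the capacity-achieving output distribution of the synchronous channel, i.e. there is no $P$ with $I(PQ)=C$ whose output distribution $\sum_xP(x)Q(\cdot|x)$ equals $Q_\star$, and that $\alpha_\circ<\infty$. Then there is a threshold $R_*$ with $0\le R_*<C$, depending only on the channel, such that $$\alpha^{\mathrm T}(R)<\alpha(R)\qquad\text{for all } R\in(R_*,C].$$ -/

import Mathlib

noncomputable section

open scoped NNReal ENNReal
open Filter

namespace AsyncComm

/-- A discrete memoryless channel with finite alphabets: `Q x` is the law of the output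
when the input is `x`, and `Q x y` is the transition probability from `x` to `y`. -/
abbrev Channel (X Y : Type*) [Fintype Y] := X → stdSimplex ℝ Y

section Information

variable {X Y : Type*} [Fintype X] [Fintype Y]

/-- The output distribution of the channel for the input distribution `P`. -/
def outputDist (Q : Channel X Y) (P : stdSimplex ℝ X) (y : Y) : ℝ :=
  ∑ x, P x * Q x y

/-- The mutual information (in nats) between input and output, for the input distribution `P`.
Only terms with `P x > 0` and `Q x y > 0` contribute, and there the denominator is positive. -/
def mutualInfo (Q : Channel X Y) (P : stdSimplex ℝ X) : ℝ :=
  ∑ x, P x * ∑ y, Q x y * Real.log (Q x y / outputDist Q P y)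

/-- The capacity of the synchronous channel. -/
def capacity (Q : Channel X Y) : ℝ :=
  ⨆ P : stdSimplex ℝ X, mutualInfo Q P

/-- `μ` is the output distribution of the channel under a capacity-achieving input
distribution. -/
def IsCapacityAchievingOutput (Q : Channel X Y) (μ : stdSimplex ℝ Y) : Prop :=
  ∃ P : stdSimplex ℝ X, mutualInfo Q P = capacity Q ∧ ∀ y, outputDist Q P y = μ y

/-- Information divergence `D(p ‖ q)` on a finite alphabet, with `0 ln (0 / q) = 0` and
`p ln (p / 0) = ∞` for `p > 0`. -/
def divergence (p q : stdSimplex ℝ Y) : EReal :=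
  ∑ y, if p y = 0 then 0 else if q y = 0 then ⊤
    else ((p y * Real.log (p y / q y) : ℝ) : EReal)

/-- The synchronization threshold: the largest divergence between the output distribution of
an input symbol and the noise distribution `Q star`. -/
def syncThreshold (Q : Channel X Y) (star : X) : EReal :=
  ⨆ x, divergence (Q x) (Q star)

end Information

/-- A code of block length `n` for asynchronous communication.

The channel outputs at the times `1, …, level + n - 1` are indexed by `Fin (level + n - 1)`,
the index `i` being time `i + 1`; likewise the transmission start is indexed by `Fin level`.

The decoder stops according to a possibly randomized stopping time. On a finite time horizon
with finite alphabets there are only finitely many deterministic stopping rules, and a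
randomized one is a probability distribution over these: a seed `k`, independent of the message,
of the starting time and of the channel, is drawn with probability `seedProb k`, and then the
deterministic rule `stopAt k` is used. Having stopped at `t`, the decoder declares a function of
the outputs observed up to and including `t`. -/
structure Code (X Y : Type*) (n : ℕ) where
  /-- the number of messages -/
  numMsg : ℕ
  two_le_numMsg : 2 ≤ numMsg
  /-- the codewords -/
  codeword : Fin numMsg → Fin n → X
  /-- the asynchronism level -/
  level : ℕ
  one_le_level : 1 ≤ level
  /-- the number of seeds of the stopping rule -/
  numSeed : ℕ
  seedProb : Fin numSeed → ℝ
  seedProb_nonneg : ∀ k, 0 ≤ seedProb k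
  seedProb_sum : ∑ k, seedProb k = 1
  /-- the stopping rules -/
  stopAt : Fin numSeed → (Fin (level + n - 1) → Y) → Fin (level + n - 1)
  stopAt_adapted : ∀ (k : Fin numSeed) (y y' : Fin (level + n - 1) → Y),
    (∀ i, i ≤ stopAt k y → y' i = y i) → stopAt k y' = stopAt k y
  /-- the decision rule, as a function of the observed outputs -/
  decisionRule : (t : Fin (level + n - 1)) → (Fin ((t : ℕ) + 1) → Y) → Fin numMsg

namespace Code

variable {X Y : Type*} {n : ℕ}

/-- The channel input over time when message `m` starts being sent at `s`: the codeword during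
`s, …, s + n - 1`, and the idle symbol `star` before and after. -/
def input (c : Code X Y n) (star : X) (m : Fin c.numMsg) (s : Fin c.level)
    (i : Fin (c.level + n - 1)) : X :=
  if h : (s : ℕ) ≤ i ∧ (i : ℕ) < s + n then c.codeword m ⟨i - s, by omega⟩ else star

/-- The message declared for the output sequence `y` with the seed `k`. -/
def decoded (c : Code X Y n) (k : Fin c.numSeed) (y : Fin (c.level + n - 1) → Y) :
    Fin c.numMsg :=
  c.decisionRule (c.stopAt k y) fun i => y ⟨i, lt_of_lt_of_le i.isLt (c.stopAt k y).isLt⟩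

variable [Fintype Y]

/-- The expectation of `f (seed, outputs)`, given that message `m` starts being sent at `s`. -/
def expect (c : Code X Y n) (Q : Channel X Y) (star : X) (m : Fin c.numMsg) (s : Fin c.level)
    (f : Fin c.numSeed → (Fin (c.level + n - 1) → Y) → ℝ) : ℝ :=
  ∑ k, c.seedProb k * ∑ y : Fin (c.level + n - 1) → Y,
    (∏ i, Q (c.input star m s i) (y i)) * f k y

/-- The decoding error probability: maximum over messages, average over starting times. -/
def errorProb (c : Code X Y n) (Q : Channel X Y) (star : X) : ℝ :=
  ⨆ m, (1 / (c.level : ℝ)) * ∑ s, c.expect Q star m s fun k y =>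
    if c.decoded k y ≠ m then 1 else 0

/-- The expected reaction delay: maximum over messages, average over starting times. The
truncated subtraction of natural numbers is the positive part of the difference. -/
def delay (c : Code X Y n) (Q : Channel X Y) (star : X) : ℝ :=
  ⨆ m, (1 / (c.level : ℝ)) * ∑ s, c.expect Q star m s fun k y =>
    (((c.stopAt k y : ℕ) - (s : ℕ) : ℕ) : ℝ)

/-- The rate `ln M / Δ`, which is infinite when the delay `Δ` is zero. -/
def rate (c : Code X Y n) (Q : Channel X Y) (star : X) : ℝ≥0∞ :=
  ENNReal.ofReal (Real.log c.numMsg) / ENNReal.ofReal (c.delay Q star)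

/-- All codewords start with the same `l` symbols. -/
def HasCommonPreamble (c : Code X Y n) (l : ℕ) : Prop :=
  ∀ (m m' : Fin c.numMsg) (i : Fin n), (i : ℕ) < l → c.codeword m i = c.codeword m' i

/-- The stopping rule is a sliding-window rule: whether the decoder, if it has not stopped before
time `t`, stops at time `t`, depends only on the seed and on the outputs at the `l` times
`t - n + 1, …, t - n + l` (those of them that lie in the observation period), hence, given these
outputs, is independent of all other outputs. -/
def HasWindowStopping (c : Code X Y n) (l : ℕ) : Prop :=
  ∀ (k : Fin c.numSeed) (t : Fin (c.level + n - 1)) (y y' : Fin (c.level + n - 1) → Y),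
    t ≤ c.stopAt k y → t ≤ c.stopAt k y' →
    (∀ i : Fin (c.level + n - 1),
      (t : ℕ) + 1 ≤ (i : ℕ) + n → (i : ℕ) + n ≤ (t : ℕ) + l → y i = y' i) →
    (c.stopAt k y = t ↔ c.stopAt k y' = t)

end Code

section Capacity

variable {X Y : Type*}

/-- The sequence of codes `S` (one for each block length) achieves the rate `R` at the
asynchronism exponent `α`: for every `ε > 0` and all large `n`, up to `ε` the asynchronism
exponent of `S n` is `α`, its rate is at least `R - ε`, and its maximum error probability is at
most `ε`. -/
def Achieves [Fintype Y] (Q : Channel X Y) (star : X) (S : (n : ℕ) → Code X Y n) (R α : ℝ) :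
    Prop :=
  ∀ ε : ℝ, 0 < ε → ∀ᶠ n : ℕ in atTop,
    (Real.exp ((α - ε) * n) ≤ (S n).level ∧ ((S n).level : ℝ) ≤ Real.exp ((α + ε) * n)) ∧
    ENNReal.ofReal (R - ε) ≤ (S n).rate Q star ∧
    (S n).errorProb Q star ≤ ε

/-- Training-based schemes: for some `η ∈ [0, 1]` and all large `n`, the codewords share a
preamble of length `η n`, and the decision to stop at time `t` is based on the `η n` outputs at
times `t - n + 1, …, t - n + η n`. -/
def IsTrainingBased (S : (n : ℕ) → Code X Y n) : Prop :=
  ∃ η : ℝ, 0 ≤ η ∧ η ≤ 1 ∧ ∀ᶠ n : ℕ in atTop,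
    (S n).HasCommonPreamble ⌊η * n⌋₊ ∧ (S n).HasWindowStopping ⌊η * n⌋₊

/-- The asynchronous capacity `α(R)`: the supremum of the asynchronism exponents that are
achievable at rate `R`. -/
def asyncCapacity [Fintype Y] (Q : Channel X Y) (star : X) (R : ℝ) : ℝ≥0∞ :=
  sSup {a : ℝ≥0∞ | ∃ α : ℝ≥0, a = α ∧
    ∃ S : (n : ℕ) → Code X Y n, Achieves Q star S R α}

/-- The asynchronous capacity restricted to training-based schemes. -/
def trainingCapacity [Fintype Y] (Q : Channel X Y) (star : X) (R : ℝ) : ℝ≥0∞ :=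
  sSup {a : ℝ≥0∞ | ∃ α : ℝ≥0, a = α ∧
    ∃ S : (n : ℕ) → Code X Y n, IsTrainingBased S ∧ Achieves Q star S R α}

end Capacity

end AsyncComm

end

/-! Two bounds squeeze the capacities apart near `C`. Training-based schemes lose all asynchronism
as the rate approaches capacity: `α^T(R) ≤ ln K · (C - R)/R`, where `K` bounds all likelihood ratios
`Q(y|x)/Q_⋆(y)` (`trainingCapacity_le`). General schemes keep a fixed exponent `δ > 0` at every rate
up to `C` (`exists_pos_le_asyncCapacity`). The upper bound equals `δ` at `R = C ln K/(ln K + δ)`,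
which serves as the threshold.

Converse. Let the preamble have length `l` and put `v ≈ θn`. At a time less than `n - l + v` after
the start, the window of the stopping rule has seen at most `v` codeword symbols, so by a change of
measure stopping there is at most `K^v` times as likely as a corresponding event under pure noise.
For each noise sequence that event occurs at no more than `v` times. Averaged over `A = e^{αn}`
starting times, such stops therefore have vanishing probability when `θ ln K < α`. Stopping before
the start amounts to guessing, so the delay is essentially at least `n - l + θn`
(`HasWindowStopping.le_delay`). Only `n - l` symbols carry information, so Fano's inequality gives
`ln M ≲ C(n - l)` (`HasCommonPreamble.log_numMsg_le`). Together these force `Rθ ≤ C - R`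
(`IsTrainingBased.mul_le`).

Achievability. Codewords drawn from a capacity-achieving `P` produce outputs that look like `q = PQ
≠ Q_⋆`, so the information-bearing symbols themselves reveal the transmission. A likelihood ratio
test of `q` against `Q_⋆` on blocks of length `n` has false-alarm probability, and miss probability
averaged over the codebook, at most `ρ^n`, with `ρ < 1` the Bhattacharyya coefficient. This survives
multiplication by `A` as long as `e^δ ρ < 1`. After detection, a threshold test on the information
density finds the message. Random coding with expurgation makes the bounds uniform over messages
(`exists_code_of_params`).

Both halves need the Kuhn–Tucker facts on the optimal output law: it has full support, and
`D(Q(·|x)‖q) ≤ C` for every `x`. -/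

noncomputable section

open scoped NNReal ENNReal
open Filter

namespace AsyncComm

/-! ### Expectations under finite product laws. -/

section ProdExpect

variable {ι Z : Type*} [Fintype ι] [DecidableEq ι] [Fintype Z]

/-- The expectation of `f` under the product of the weight functions `p i`. -/
def prodExpect (p : ι → Z → ℝ) (f : (ι → Z) → ℝ) : ℝ :=
  ∑ z, (∏ i, p i (z i)) * f z

theorem prodExpect_prod (p g : ι → Z → ℝ) :
    prodExpect p (fun z => ∏ i, g i (z i)) = ∏ i, ∑ b, p i b * g i b := by
  unfold prodExpect
  simp_rw [← Finset.prod_mul_distrib]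
  rw [Finset.prod_univ_sum, Fintype.piFinset_univ]

theorem prodExpect_one {p : ι → Z → ℝ} (hp : ∀ i, ∑ b, p i b = 1) :
    prodExpect p (fun _ => 1) = 1 := by
  have := prodExpect_prod p (fun _ _ => 1)
  simpa [hp] using this

theorem prodExpect_const {p : ι → Z → ℝ} (hp : ∀ i, ∑ b, p i b = 1) (a : ℝ) :
    prodExpect p (fun _ => a) = a := by
  have := prodExpect_one hp
  unfold prodExpect at *
  rw [← Finset.sum_mul]
  simp only [mul_one] at this
  rw [this, one_mul]

theorem prodExpect_add (p : ι → Z → ℝ) (f g : (ι → Z) → ℝ) :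
    prodExpect p (fun z => f z + g z) = prodExpect p f + prodExpect p g := by
  simp [prodExpect, mul_add, Finset.sum_add_distrib]

theorem prodExpect_mul_left (p : ι → Z → ℝ) (a : ℝ) (f : (ι → Z) → ℝ) :
    prodExpect p (fun z => a * f z) = a * prodExpect p f := by
  simp only [prodExpect, Finset.mul_sum]
  exact Finset.sum_congr rfl fun z _ => by ring

theorem prodExpect_sum {κ : Type*} (s : Finset κ) (p : ι → Z → ℝ) (f : κ → (ι → Z) → ℝ) :
    prodExpect p (fun z => ∑ j ∈ s, f j z) = ∑ j ∈ s, prodExpect p (f j) := by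
  simp only [prodExpect, Finset.mul_sum]
  exact Finset.sum_comm

theorem prodExpect_mono {p : ι → Z → ℝ} (hp : ∀ i b, 0 ≤ p i b) {f g : (ι → Z) → ℝ}
    (h : ∀ z, f z ≤ g z) : prodExpect p f ≤ prodExpect p g :=
  Finset.sum_le_sum fun z _ =>
    mul_le_mul_of_nonneg_left (h z) (Finset.prod_nonneg fun i _ => hp i _)

theorem prodExpect_nonneg {p : ι → Z → ℝ} (hp : ∀ i b, 0 ≤ p i b) {f : (ι → Z) → ℝ}
    (h : ∀ z, 0 ≤ f z) : 0 ≤ prodExpect p f :=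
  Finset.sum_nonneg fun z _ => mul_nonneg (Finset.prod_nonneg fun i _ => hp i _) (h z)

/-- An inequality in expectation holds at some point. -/
theorem exists_le_of_prodExpect_le {p : ι → Z → ℝ} (hp : ∀ i b, 0 ≤ p i b)
    (hp1 : ∀ i, ∑ b, p i b = 1) {f : (ι → Z) → ℝ} {a : ℝ} (h : prodExpect p f ≤ a) :
    ∃ z, f z ≤ a := by
  by_contra! hf
  have h1 : prodExpect p (fun _ => a) = a := prodExpect_const hp1 a
  have h2 : ∑ z : ι → Z, ∏ i, p i (z i) = 1 := by simpa [prodExpect] using prodExpect_one hp1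
  have h3 : ∃ z ∈ (Finset.univ : Finset (ι → Z)), (0 : ℝ) < ∏ i, p i (z i) := by
    apply Finset.exists_lt_of_sum_lt (f := fun _ => (0 : ℝ))
    simp [h2]
  obtain ⟨z, -, hz⟩ := h3
  have h4 : prodExpect p (fun _ => a) < prodExpect p f :=
    Finset.sum_lt_sum (fun z _ => mul_le_mul_of_nonneg_left (hf z).le
      (Finset.prod_nonneg fun i _ => hp i _)) ⟨z, Finset.mem_univ _, by
        exact mul_lt_mul_of_pos_left (hf z) hz⟩
  linarith

/-- The expectation does not change when one coordinate is resampled. -/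
theorem prodExpect_resample {p : ι → Z → ℝ} (hp : ∀ i, ∑ b, p i b = 1) (j : ι)
    (f : (ι → Z) → ℝ) :
    prodExpect p f = prodExpect p (fun z => ∑ b, p j b * f (Function.update z j b)) := by
  unfold prodExpect
  rw [← (Equiv.piSplitAt j fun _ => Z).symm.sum_comp,
    ← (Equiv.piSplitAt j fun _ => Z).symm.sum_comp, Fintype.sum_prod_type_right,
    Fintype.sum_prod_type_right]
  refine Finset.sum_congr rfl fun r _ => ?_
  have key : ∀ b, (∏ i, p i ((Equiv.piSplitAt j fun _ => Z).symm (b, r) i)) =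
      p j b * ∏ i : {i // i ≠ j}, p i (r i) := by
    intro b
    rw [← Fintype.prod_subtype_mul_prod_subtype (fun i => i = j)]
    congr 1
    · refine (Finset.prod_eq_single ⟨j, rfl⟩ ?_ ?_).trans ?_
      · rintro ⟨i, rfl⟩ - h
        exact absurd rfl h
      · exact fun h => absurd (@Finset.mem_univ _ (_) _) h
      · simp
    · refine Finset.prod_congr rfl fun i _ => ?_
      simp [i.2]
  have upd : ∀ b b', Function.update ((Equiv.piSplitAt j fun _ => Z).symm (b, r)) j b' =
      (Equiv.piSplitAt j fun _ => Z).symm (b', r) := by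
    intro b b'
    ext i
    by_cases h : i = j
    · subst h; simp
    · simp [h]
  simp_rw [key, upd]
  rw [← Finset.sum_mul, ← Finset.sum_mul, hp j, one_mul, Finset.mul_sum]
  exact Finset.sum_congr rfl fun b _ => by ring

/-- The expectation of a function of a single coordinate. -/
theorem prodExpect_eval {p : ι → Z → ℝ} (hp : ∀ i, ∑ b, p i b = 1) (j : ι) (g : Z → ℝ) :
    prodExpect p (fun z => g (z j)) = ∑ b, p j b * g b := by
  rw [prodExpect_resample hp j]
  simp only [Function.update_self]
  exact prodExpect_const hp _

/-- The expectation of a function that depends only on the coordinates in `U` depends only on the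
weights of these coordinates. -/
theorem prodExpect_congr_of_dependsOn {p p' : ι → Z → ℝ} (hp : ∀ i, ∑ b, p i b = 1)
    (hp' : ∀ i, ∑ b, p' i b = 1) (U : ι → Prop) (hU : ∀ i, U i → p i = p' i)
    {f : (ι → Z) → ℝ} (hf : ∀ z z', (∀ i, U i → z i = z' i) → f z = f z') :
    prodExpect p f = prodExpect p' f := by
  classical
  have split : ∀ r : ι → Z → ℝ, (∀ i, ∑ b, r i b = 1) → prodExpect r f =
      ∑ u : {i // U i} → Z, (∏ i : {i // U i}, r i (u i)) *
        ∑ v : {i // ¬ U i} → Z, (∏ i : {i // ¬ U i}, r i (v i)) *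
          f ((Equiv.piEquivPiSubtypeProd U fun _ => Z).symm (u, v)) := by
    intro r hr
    unfold prodExpect
    rw [← (Equiv.piEquivPiSubtypeProd U fun _ => Z).symm.sum_comp, Fintype.sum_prod_type]
    refine Finset.sum_congr rfl fun u _ => ?_
    rw [Finset.mul_sum]
    refine Finset.sum_congr rfl fun v _ => ?_
    rw [← Fintype.prod_subtype_mul_prod_subtype U, mul_assoc]
    congr 1
    · exact Finset.prod_congr rfl fun i _ => by simp [i.2]
    · congr 1
      exact Finset.prod_congr rfl fun i _ => by simp [i.2]
  rw [split p hp, split p' hp']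
  refine Finset.sum_congr rfl fun u _ => ?_
  congr 1
  · exact Finset.prod_congr rfl fun i _ => by rw [hU i i.2]
  -- A letter `b` is needed to fill the coordinates outside `U`. An empty alphabet carries no
  -- probability law unless there are no coordinates.
  · rcases isEmpty_or_nonempty Z with hZ | ⟨⟨b⟩⟩
    · by_cases h : ∃ _ : ι, True
      · obtain ⟨i, -⟩ := h
        simpa using hp i
      · have : IsEmpty ι := ⟨fun i => h ⟨i, trivial⟩⟩
        simp
    · have hc : ∀ v : {i // ¬ U i} → Z,
          f ((Equiv.piEquivPiSubtypeProd U fun _ => Z).symm (u, v)) =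
          f ((Equiv.piEquivPiSubtypeProd U fun _ => Z).symm (u, fun _ => b)) := by
        intro v
        refine hf _ _ fun i hi => ?_
        simp [hi]
      simp_rw [hc]
      have e1 := prodExpect_const (fun i : {i // ¬ U i} => hp i)
        (f ((Equiv.piEquivPiSubtypeProd U fun _ => Z).symm (u, fun _ => b)))
      have e2 := prodExpect_const (fun i : {i // ¬ U i} => hp' i)
        (f ((Equiv.piEquivPiSubtypeProd U fun _ => Z).symm (u, fun _ => b)))
      unfold prodExpect at e1 e2
      rw [e1, e2]

/-- A variational bound for the expectation of `f` by the divergence of product laws. -/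
theorem prodExpect_le_divergence {p p' : ι → Z → ℝ} (h0 : ∀ i b, 0 ≤ p i b)
    (h0' : ∀ i b, 0 ≤ p' i b) (hp : ∀ i, ∑ b, p i b = 1)
    (hac : ∀ i b, 0 < p i b → 0 < p' i b) (f : (ι → Z) → ℝ) {a : ℝ} (ha : 0 < a) :
    prodExpect p f ≤ (∑ i, ∑ b, p i b * Real.log (p i b / p' i b)) + Real.log a - 1 +
      prodExpect p' (fun z => Real.exp (f z)) / a := by
  -- Donsker–Varadhan with `ln E ≤ ln a - 1 + E/a`, so that the bound is linear in the expectation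
  -- under `p'`. Pointwise it is `ln u ≤ u - 1` at `u = e^f ∏ p' / (a ∏ p)`.
  have h1 : prodExpect p f ≤ prodExpect p
      (fun z => (∑ i, Real.log (p i (z i) / p' i (z i))) + (Real.log a - 1)) +
      prodExpect p' (fun z => a⁻¹ * Real.exp (f z)) := by
    unfold prodExpect
    rw [← Finset.sum_add_distrib]
    refine Finset.sum_le_sum fun z _ => ?_
    have hP : 0 ≤ ∏ i, p i (z i) := Finset.prod_nonneg fun i _ => h0 i _
    have hP' : 0 ≤ ∏ i, p' i (z i) := Finset.prod_nonneg fun i _ => h0' i _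
    rcases hP.eq_or_lt with h | h
    · rw [← h]
      have := Real.exp_pos (f z)
      simp only [zero_mul, zero_add]
      positivity
    · have hi : ∀ i, 0 < p i (z i) := fun i => (h0 i _).lt_of_ne fun h2 =>
        h.ne (Finset.prod_eq_zero (Finset.mem_univ i) h2.symm).symm
      have hi' : ∀ i, 0 < p' i (z i) := fun i => hac i _ (hi i)
      have hP'p : 0 < ∏ i, p' i (z i) := Finset.prod_pos fun i _ => hi' i
      have hlog : ∑ i, Real.log (p i (z i) / p' i (z i)) =
          Real.log (∏ i, p i (z i)) - Real.log (∏ i, p' i (z i)) := by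
        rw [Real.log_prod (fun i _ => (hi i).ne'), Real.log_prod (fun i _ => (hi' i).ne'),
          ← Finset.sum_sub_distrib]
        exact Finset.sum_congr rfl fun i _ => Real.log_div (hi i).ne' (hi' i).ne'
      have hu := Real.log_le_sub_one_of_pos (x := Real.exp (f z) * (∏ i, p' i (z i)) /
        ((∏ i, p i (z i)) * a)) (by positivity)
      rw [Real.log_div (by positivity) (by positivity), Real.log_mul (by positivity)
        (by positivity), Real.log_mul (by positivity) (by positivity), Real.log_exp] at hu
      have hu2 := mul_le_mul_of_nonneg_left hu hP
      have e : (∏ i, p i (z i)) * (Real.exp (f z) * (∏ i, p' i (z i)) /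
        ((∏ i, p i (z i)) * a) - 1) = (∏ i, p' i (z i)) * (a⁻¹ * Real.exp (f z))
          - ∏ i, p i (z i) := by
        field_simp
      rw [e] at hu2
      beta_reduce
      rw [hlog]
      nlinarith
  rw [prodExpect_add, prodExpect_const hp, prodExpect_sum, prodExpect_mul_left] at h1
  have h2 : ∀ i, prodExpect p (fun z => Real.log (p i (z i) / p' i (z i))) =
      ∑ b, p i b * Real.log (p i b / p' i b) := fun i =>
    prodExpect_eval hp i (fun b => Real.log (p i b / p' i b))
  simp_rw [h2] at h1
  rw [div_eq_inv_mul]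
  linarith

end ProdExpect

/-! ### Capacity-achieving distributions and the Kuhn–Tucker condition. -/

section CapacityAchieving

variable {X Y : Type*} [Fintype X] [Fintype Y]

theorem outputDist_nonneg (Q : Channel X Y) (P : stdSimplex ℝ X) (y : Y) :
    0 ≤ outputDist Q P y :=
  Finset.sum_nonneg fun x _ => mul_nonneg (stdSimplex.zero_le P x) (stdSimplex.zero_le (Q x) y)

theorem sum_outputDist (Q : Channel X Y) (P : stdSimplex ℝ X) : ∑ y, outputDist Q P y = 1 := by
  unfold outputDist
  rw [Finset.sum_comm]
  simp [← Finset.mul_sum]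

theorem mul_le_outputDist (Q : Channel X Y) (P : stdSimplex ℝ X) (x : X) (y : Y) :
    P x * Q x y ≤ outputDist Q P y :=
  Finset.single_le_sum (f := fun x => P x * Q x y)
    (fun x _ => mul_nonneg (stdSimplex.zero_le P x) (stdSimplex.zero_le (Q x) y))
    (Finset.mem_univ x)

/-- A linear term plus the output entropy: in this form continuity in `P` holds up to the boundary
of the simplex, where the quotient inside the logarithm misbehaves. -/
theorem mutualInfo_eq (Q : Channel X Y) (P : stdSimplex ℝ X) :
    mutualInfo Q P = ∑ x, P x * ∑ y, Q x y * Real.log (Q x y) +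
      ∑ y, Real.negMulLog (outputDist Q P y) := by
  have h1 : ∑ y, Real.negMulLog (outputDist Q P y) =
      ∑ x, P x * ∑ y, - (Q x y * Real.log (outputDist Q P y)) := by
    simp_rw [Finset.mul_sum]
    rw [Finset.sum_comm]
    refine Finset.sum_congr rfl fun y _ => ?_
    simp only [Real.negMulLog, neg_mul]
    conv_lhs => rw [outputDist, Finset.sum_mul, ← Finset.sum_neg_distrib]
    exact Finset.sum_congr rfl fun x _ => by rw [outputDist]; ring
  rw [h1, mutualInfo, ← Finset.sum_add_distrib]
  refine Finset.sum_congr rfl fun x _ => ?_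
  rw [← mul_add, ← Finset.sum_add_distrib, Finset.mul_sum, Finset.mul_sum]
  refine Finset.sum_congr rfl fun y _ => ?_
  rcases (mul_nonneg (stdSimplex.zero_le P x) (stdSimplex.zero_le (Q x) y)).eq_or_lt with h | h
  · rcases mul_eq_zero.1 h.symm with h | h <;> simp [h]
  · have hq := h.trans_le (mul_le_outputDist Q P x y)
    have hQ : Q x y ≠ 0 := fun h0 => by simp [h0] at h
    rw [Real.log_div hQ hq.ne']
    ring

theorem continuous_mutualInfo (Q : Channel X Y) : Continuous (mutualInfo Q) := by
  have hc : ∀ x, Continuous fun P : stdSimplex ℝ X => P x := fun x =>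
    (continuous_apply x).comp continuous_subtype_val
  have : mutualInfo Q = fun P : stdSimplex ℝ X => ∑ x, P x * ∑ y, Q x y * Real.log (Q x y) +
      ∑ y, Real.negMulLog (outputDist Q P y) := funext (mutualInfo_eq Q)
  rw [this]
  unfold outputDist
  refine (continuous_finsetSum _ fun x _ => (hc x).mul continuous_const).add
    (continuous_finsetSum _ fun y _ => Real.continuous_negMulLog.comp ?_)
  exact continuous_finsetSum _ fun x _ => (hc x).mul continuous_const

theorem mutualInfo_le_capacity (Q : Channel X Y) (P : stdSimplex ℝ X) :
    mutualInfo Q P ≤ capacity Q :=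
  le_ciSup (isCompact_range (continuous_mutualInfo Q)).bddAbove P

theorem exists_mutualInfo_eq_capacity [Nonempty X] (Q : Channel X Y) :
    ∃ P, mutualInfo Q P = capacity Q := by
  obtain ⟨P, -, hP⟩ := isCompact_univ.exists_isMaxOn Set.univ_nonempty
    (continuous_mutualInfo Q).continuousOn
  exact ⟨P, le_antisymm (mutualInfo_le_capacity Q P) (ciSup_le fun P' => hP (Set.mem_univ P'))⟩

/-- The mutual information is the minimum over `r` of the average divergence from `r`. -/
theorem mutualInfo_le_of_pos (Q : Channel X Y) (P : stdSimplex ℝ X) (r : Y → ℝ)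
    (hr : ∀ y, 0 ≤ r y) (hr1 : ∑ y, r y ≤ 1) (hpos : ∀ y, 0 < outputDist Q P y → 0 < r y) :
    mutualInfo Q P ≤ ∑ x, P x * ∑ y, Q x y * Real.log (Q x y / r y) := by
  -- The gap between the two sides of the claim is the divergence of the output law from `r`,
  -- bounded below through `ln u ≤ u - 1`.
  have h1 : mutualInfo Q P ≤ ∑ x, P x * ∑ y, Q x y * Real.log (Q x y / r y) +
      ∑ x, ∑ y, P x * Q x y * (r y / outputDist Q P y - 1) := by
    rw [mutualInfo, ← Finset.sum_add_distrib]
    refine Finset.sum_le_sum fun x _ => ?_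
    rw [Finset.mul_sum, Finset.mul_sum, ← Finset.sum_add_distrib]
    refine Finset.sum_le_sum fun y _ => ?_
    rcases (mul_nonneg (stdSimplex.zero_le P x) (stdSimplex.zero_le (Q x) y)).eq_or_lt with h | h
    · rcases mul_eq_zero.1 h.symm with h | h <;> simp [h]
    · have hq := h.trans_le (mul_le_outputDist Q P x y)
      have hQ : Q x y ≠ 0 := fun h0 => by simp [h0] at h
      have hl := Real.log_le_sub_one_of_pos (div_pos (hpos y hq) hq)
      rw [Real.log_div (hpos y hq).ne' hq.ne'] at hl
      rw [Real.log_div hQ hq.ne', Real.log_div hQ (hpos y hq).ne']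
      nlinarith
  have h2 : ∑ x, ∑ y, P x * Q x y * (r y / outputDist Q P y - 1) ≤ 0 := by
    rw [Finset.sum_comm]
    calc _ = ∑ y, outputDist Q P y * (r y / outputDist Q P y - 1) :=
          Finset.sum_congr rfl fun y _ => by rw [← Finset.sum_mul]; rfl
      _ ≤ ∑ y, (r y - outputDist Q P y) := by
          refine Finset.sum_le_sum fun y _ => ?_
          rcases (outputDist_nonneg Q P y).eq_or_lt with h | h
          · rw [← h]; simpa using hr y
          · apply le_of_eq
            field_simp
      _ ≤ 0 := by
          rw [Finset.sum_sub_distrib, sum_outputDist]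
          linarith
  linarith

/-- The input distribution that picks `x` with probability `a` and is drawn from `P` otherwise. -/
def mixInput [DecidableEq X] (P : stdSimplex ℝ X) (x : X) (a : ℝ) (h0 : 0 ≤ a) (h1 : a ≤ 1) :
    stdSimplex ℝ X :=
  ⟨fun x' => (1 - a) * P x' + a * (Pi.single x 1 : X → ℝ) x',
    convex_stdSimplex ℝ X P.2 (single_mem_stdSimplex ℝ x) (by linarith) h0 (by ring)⟩

theorem mixInput_apply [DecidableEq X] (P : stdSimplex ℝ X) (x : X) (a : ℝ) (h0 : 0 ≤ a)
    (h1 : a ≤ 1) (x' : X) :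
    mixInput P x a h0 h1 x' = (1 - a) * P x' + a * (if x' = x then 1 else 0) := by
  simp only [mixInput, DFunLike.coe, Pi.single_apply]

theorem sum_mixInput_mul [DecidableEq X] (P : stdSimplex ℝ X) (x : X) (a : ℝ) (h0 : 0 ≤ a)
    (h1 : a ≤ 1) (f : X → ℝ) :
    ∑ x', mixInput P x a h0 h1 x' * f x' = (1 - a) * ∑ x', P x' * f x' + a * f x := by
  simp only [mixInput_apply, add_mul, Finset.sum_add_distrib, Finset.mul_sum, mul_assoc]
  simp

/-- Shifting weight `a` from `P` to `x` cannot raise the mutual information above `C`. With `q_a`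
the mixed output law, it equals `(1 - a) ∑ P D(Q(·|x')‖q_a) + a D(Q(·|x)‖q_a)`, and the first sum is
at least `I(PQ) = C`. -/
theorem sum_mul_log_mix_le_capacity [DecidableEq X] (Q : Channel X Y) {P : stdSimplex ℝ X}
    (hP : mutualInfo Q P = capacity Q) (x : X) {a : ℝ} (h0 : 0 < a) (h1 : a < 1) :
    ∑ y, Q x y * Real.log (Q x y / ((1 - a) * outputDist Q P y + a * Q x y)) ≤ capacity Q := by
  have hout : ∀ y, outputDist Q (mixInput P x a h0.le h1.le) y =
      (1 - a) * outputDist Q P y + a * Q x y := fun y =>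
    sum_mixInput_mul P x a h0.le h1.le fun x' => Q x' y
  have hle := mutualInfo_le_capacity Q (mixInput P x a h0.le h1.le)
  rw [mutualInfo, sum_mixInput_mul] at hle
  simp_rw [hout] at hle
  have hge := mutualInfo_le_of_pos Q P (fun y => (1 - a) * outputDist Q P y + a * Q x y)
    (fun y => by rw [← hout]; exact outputDist_nonneg Q _ y)
    (by simp_rw [← hout]; rw [sum_outputDist])
    (fun y hy => by
      have := mul_pos (sub_pos.2 h1) hy
      have := mul_nonneg h0.le (stdSimplex.zero_le (Q x) y)
      linarith)
  rw [hP] at hge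
  nlinarith

/-- If `q(y) = 0`, mixing in an input `x` that reaches `y` gives that output probability only `a
Q(y|x)`. The divergence of `Q(·|x)` from the mixture then grows like `-Q(y|x) ln a`, which
contradicts the bound by `C` as `a → 0`. -/
theorem outputDist_pos_of_capacity {Q : Channel X Y} (hreach : ∀ y, ∃ x, 0 < Q x y)
    {P : stdSimplex ℝ X} (hP : mutualInfo Q P = capacity Q) (y : Y) : 0 < outputDist Q P y := by
  classical
  refine (outputDist_nonneg Q P y).lt_of_ne fun h => ?_
  obtain ⟨x, hx⟩ := hreach y
  set B := ∑ y', Q x y' * Real.log (Q x y') with hB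
  have key : ∀ a : ℝ, 0 < a → a < 1 → B - Q x y * Real.log a - Q x y * Real.log (Q x y) ≤
      capacity Q := by
    intro a h0 h1
    refine le_trans ?_ (sum_mul_log_mix_le_capacity Q hP x h0 h1)
    rw [hB, ← Finset.add_sum_erase _ _ (Finset.mem_univ y),
      ← Finset.add_sum_erase _ (fun y' => Q x y' * Real.log (Q x y' / _)) (Finset.mem_univ y)]
    have e1 : Q x y * Real.log (Q x y / ((1 - a) * outputDist Q P y + a * Q x y)) =
        - (Q x y * Real.log a) := by
      rw [← h, mul_zero, zero_add, Real.log_div hx.ne' (by positivity),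
        Real.log_mul h0.ne' hx.ne']
      ring
    have e2 : ∑ y' ∈ Finset.univ.erase y, Q x y' * Real.log (Q x y') ≤
        ∑ y' ∈ Finset.univ.erase y,
          Q x y' * Real.log (Q x y' / ((1 - a) * outputDist Q P y' + a * Q x y')) := by
      refine Finset.sum_le_sum fun y' _ => ?_
      rcases (stdSimplex.zero_le (Q x) y').eq_or_lt with h' | h'
      · simp [← h']
      · refine mul_le_mul_of_nonneg_left ?_ h'.le
        have hq0 := outputDist_nonneg Q P y'
        have hq1 : outputDist Q P y' ≤ 1 := by
          rw [← sum_outputDist Q P]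
          exact Finset.single_le_sum (fun y _ => outputDist_nonneg Q P y) (Finset.mem_univ y')
        have hQ1 := stdSimplex.le_one (Q x) y'
        have h3 : 0 < (1 - a) * outputDist Q P y' + a * Q x y' := by
          have := mul_nonneg (sub_pos.2 h1).le hq0
          have := mul_pos h0 h'
          linarith
        refine Real.log_le_log h' ?_
        rw [le_div_iff₀ h3]
        have h4 : (1 - a) * outputDist Q P y' + a * Q x y' ≤ 1 := by nlinarith
        nlinarith
    rw [e1]
    linarith
  have hlim : Tendsto (fun a : ℝ => B - Q x y * Real.log a - Q x y * Real.log (Q x y))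
      (nhdsWithin 0 (Set.Ioi 0)) atTop := by
    have := (Real.tendsto_log_nhdsGT_zero.const_mul_atBot hx)
    have h5 := tendsto_neg_atBot_atTop.comp this
    have h6 := tendsto_atTop_add_const_right _ (B - Q x y * Real.log (Q x y)) h5
    refine h6.congr fun a => ?_
    simp only [Function.comp]
    ring
  have h7 := hlim.eventually_gt_atTop (capacity Q)
  have h8 : ∀ᶠ a : ℝ in nhdsWithin 0 (Set.Ioi 0), a ∈ Set.Ioo (0 : ℝ) 1 :=
    Ioo_mem_nhdsGT one_pos
  obtain ⟨a, ha, ha'⟩ := (h7.and h8).exists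
  exact absurd (key a ha'.1 ha'.2) (not_le.2 ha)

/-- The Kuhn–Tucker condition for a capacity-achieving output distribution. -/
theorem sum_mul_log_le_capacity {Q : Channel X Y} (hreach : ∀ y, ∃ x, 0 < Q x y)
    {P : stdSimplex ℝ X} (hP : mutualInfo Q P = capacity Q) (x : X) :
    ∑ y, Q x y * Real.log (Q x y / outputDist Q P y) ≤ capacity Q := by
  classical
  have hlim : Tendsto (fun a : ℝ =>
      ∑ y, Q x y * Real.log (Q x y / ((1 - a) * outputDist Q P y + a * Q x y)))
      (nhdsWithin 0 (Set.Ioi 0))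
      (nhds (∑ y, Q x y * Real.log (Q x y / outputDist Q P y))) := by
    refine tendsto_finsetSum _ fun y _ => ?_
    rcases (stdSimplex.zero_le (Q x) y).eq_or_lt with h | h
    · simp [← h]
    · have hq := outputDist_pos_of_capacity hreach hP y
      have hc : ContinuousAt (fun a : ℝ => Q x y * Real.log (Q x y /
          ((1 - a) * outputDist Q P y + a * Q x y))) 0 := by
        have hne : (1 - (0 : ℝ)) * outputDist Q P y + 0 * Q x y ≠ 0 := by simpa using hq.ne'
        refine ContinuousAt.mul (by fun_prop) (ContinuousAt.log ?_ (div_ne_zero h.ne' hne))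
        exact ContinuousAt.div (by fun_prop) (by fun_prop) hne
      have := hc.tendsto.mono_left (nhdsWithin_le_nhds (s := Set.Ioi 0))
      simpa using this
  refine le_of_tendsto hlim ?_
  have h8 : ∀ᶠ a : ℝ in nhdsWithin 0 (Set.Ioi 0), a ∈ Set.Ioo (0 : ℝ) 1 :=
    Ioo_mem_nhdsGT one_pos
  filter_upwards [h8] with a ha
  exact sum_mul_log_mix_le_capacity Q hP x ha.1 ha.2

/-- If the capacity were zero, the point mass at `star` would achieve it, with output law `Q star`.
-/
theorem capacity_pos_of_not_isCapacityAchievingOutput {Q : Channel X Y} {star : X}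
    (hout : ¬ IsCapacityAchievingOutput Q (Q star)) : 0 < capacity Q := by
  classical
  let P : stdSimplex ℝ X := ⟨Pi.single star 1, single_mem_stdSimplex ℝ star⟩
  have hPx : ∀ x, P x = if x = star then 1 else 0 := fun x => by
    simp only [P, DFunLike.coe, Pi.single_apply]
  have hq : ∀ y, outputDist Q P y = Q star y := fun y => by simp [outputDist, hPx]
  have hI : mutualInfo Q P = 0 := by
    simp only [mutualInfo, hq, hPx]
    simp only [ite_mul, one_mul, zero_mul, Finset.sum_ite_eq', Finset.mem_univ, if_true]
    refine Finset.sum_eq_zero fun y _ => ?_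
    by_cases h : Q star y = 0 <;> simp [h]
  refine lt_of_le_of_ne (hI ▸ mutualInfo_le_capacity Q P) fun h => hout ⟨P, ?_, hq⟩
  rw [hI, h]

end CapacityAchieving

/-! ### Full support of the noise and bounded likelihood ratios. -/

section Noise

variable {X Y : Type*} [Fintype Y]

/-- An output that some input reaches but the noise does not would make one of the divergences
infinite. -/
theorem noise_pos_of_syncThreshold_lt_top {Q : Channel X Y} {star : X}
    (hreach : ∀ y, ∃ x, 0 < Q x y) (hsync : syncThreshold Q star < ⊤) (y : Y) :
    0 < Q star y := by
  classical
  refine (stdSimplex.zero_le (Q star) y).lt_of_ne fun h => ?_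
  obtain ⟨x, hx⟩ := hreach y
  refine absurd hsync (not_lt.2 (le_iSup_of_le x ?_))
  rw [divergence, ← Finset.add_sum_erase _ _ (Finset.mem_univ y), if_neg hx.ne', if_pos h.symm,
    EReal.top_add_of_ne_bot]
  refine Finset.sum_induction _ (fun e : EReal => e ≠ ⊥)
    (fun a b ha hb => EReal.add_ne_bot_iff.2 ⟨ha, hb⟩) EReal.zero_ne_bot fun y' _ => ?_
  split_ifs
  · exact EReal.zero_ne_bot
  · exact top_ne_bot
  · exact EReal.coe_ne_bot _

theorem exists_one_le_le_mul_noise {Q : Channel X Y} {star : X} (h : ∀ y, 0 < Q star y) :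
    ∃ K : ℝ, 1 < K ∧ ∀ x y, Q x y ≤ K * Q star y := by
  refine ⟨2 + ∑ y, (Q star y)⁻¹, ?_, fun x y => ?_⟩
  · have : 0 ≤ ∑ y, (Q star y)⁻¹ := Finset.sum_nonneg fun y _ => (inv_pos.2 (h y)).le
    linarith
  · have h1 : (Q star y)⁻¹ ≤ ∑ y, (Q star y)⁻¹ :=
      Finset.single_le_sum (f := fun y => (Q star y)⁻¹) (fun y _ => (inv_pos.2 (h y)).le)
        (Finset.mem_univ y)
    have h2 := mul_le_mul_of_nonneg_right h1 (h y).le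
    rw [inv_mul_cancel₀ (h y).ne'] at h2
    have := stdSimplex.le_one (Q x) y
    nlinarith [h y]

end Noise

/-! ### Chernoff, Bhattacharyya and counting estimates. -/

/-- The exponential moment bound behind Chernoff's inequality: a random variable of positive mean
has a Laplace transform below one at some positive argument. -/
theorem exists_sum_mul_exp_lt_one {Z : Type*} [Fintype Z] (p a : Z → ℝ) (h1 : ∑ z, p z = 1)
    (ha : 0 < ∑ z, p z * a z) : ∃ b : ℝ, 0 < b ∧ ∑ z, p z * Real.exp (-(b * a z)) < 1 := by
  have hd : HasDerivAt (fun b : ℝ => ∑ z, p z * Real.exp (-(b * a z)))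
      (∑ z, p z * (Real.exp (-(0 * a z)) * (-(1 * a z)))) 0 := by
    refine HasDerivAt.fun_sum fun z _ => HasDerivAt.const_mul _ (HasDerivAt.exp ?_)
    exact ((hasDerivAt_id (0 : ℝ)).mul_const (a z)).neg
  have hneg : (∑ z, p z * (Real.exp (-(0 * a z)) * (-(1 * a z)))) < 0 := by
    simpa using ha
  have hlt := (hasDerivAt_iff_tendsto_slope.1 hd).eventually_lt_const hneg
  have h2 := hlt.filter_mono (nhdsWithin_mono (0 : ℝ) (s := Set.Ioi 0) (t := {0}ᶜ)
    (fun b hb => ne_of_gt hb))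
  obtain ⟨b, hb, hb0⟩ := (h2.and self_mem_nhdsWithin).exists
  refine ⟨b, hb0, ?_⟩
  rw [slope_def_field] at hb
  have hb0' : (0 : ℝ) < b := hb0
  simp only [zero_mul, neg_zero, Real.exp_zero, mul_one, h1, sub_zero] at hb
  rw [div_lt_iff₀ hb0'] at hb
  linarith

/-- The Bhattacharyya coefficient of two distinct distributions is less than one. -/
theorem sum_sqrt_mul_lt_one {Y : Type*} [Fintype Y] {p q : Y → ℝ} (hp : ∀ y, 0 ≤ p y)
    (hq : ∀ y, 0 ≤ q y) (hp1 : ∑ y, p y = 1) (hq1 : ∑ y, q y = 1) (hne : p ≠ q) :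
    ∑ y, √(p y) * √(q y) < 1 := by
  obtain ⟨y, hy⟩ := Function.ne_iff.1 hne
  have h : 0 < ∑ y, (√(p y) - √(q y)) ^ 2 := by
    refine Finset.sum_pos' (fun y _ => sq_nonneg _) ⟨y, Finset.mem_univ y, ?_⟩
    refine sq_pos_of_ne_zero (sub_ne_zero.2 fun h => hy ?_)
    exact (Real.sqrt_inj (hp y) (hq y)).1 h
  have h2 : ∑ y, (√(p y) - √(q y)) ^ 2 = ∑ y, (p y + q y - 2 * (√(p y) * √(q y))) := by
    refine Finset.sum_congr rfl fun y _ => ?_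
    have e1 := Real.sq_sqrt (hp y)
    have e2 := Real.sq_sqrt (hq y)
    nlinarith
  rw [h2, Finset.sum_sub_distrib, Finset.sum_add_distrib, hp1, hq1, ← Finset.mul_sum] at h
  linarith

theorem card_fin_filter_le {N : ℕ} (a b d : ℕ) (p : Fin N → Prop) [DecidablePred p]
    (h : ∀ i, p i → a ≤ i ∧ (i : ℕ) < b) (hb : b ≤ a + d) :
    (Finset.univ.filter p).card ≤ d := by
  calc (Finset.univ.filter p).card ≤ (Finset.Ico a b).card := by
        refine Finset.card_le_card_of_injOn Fin.val (fun i hi => ?_)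
          (fun i _ j _ hij => Fin.ext hij)
        have := h i (by simpa using hi)
        simpa using this
    _ ≤ d := by rw [Nat.card_Ico]; omega

/-! ### Window stopping rules and basic properties of codes. -/

namespace Code

variable {X Y : Type*} {n : ℕ}

/-- The outputs in the window of length `l` at time `t` make a sliding-window decoder stop at `t`,
unless it has stopped before. -/
def Fires (c : Code X Y n) (l : ℕ) (k : Fin c.numSeed) (t : Fin (c.level + n - 1))
    (y : Fin (c.level + n - 1) → Y) : Prop :=
  ∃ y' : Fin (c.level + n - 1) → Y,
    (∀ i : Fin (c.level + n - 1),
      (t : ℕ) + 1 ≤ (i : ℕ) + n → (i : ℕ) + n ≤ (t : ℕ) + l → y i = y' i) ∧ c.stopAt k y' = t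

/-- The window at time `t` makes the decoder stop, and no window at least `v` earlier does. -/
def FiresAfterSilence (c : Code X Y n) (l v : ℕ) (k : Fin c.numSeed) (t : Fin (c.level + n - 1))
    (y : Fin (c.level + n - 1) → Y) : Prop :=
  c.Fires l k t y ∧ ∀ t' : Fin (c.level + n - 1), (t' : ℕ) + v ≤ t → ¬ c.Fires l k t' y

theorem fires_congr (c : Code X Y n) {l : ℕ} {k : Fin c.numSeed} {t : Fin (c.level + n - 1)}
    {y z : Fin (c.level + n - 1) → Y}
    (h : ∀ i : Fin (c.level + n - 1),
      (t : ℕ) + 1 ≤ (i : ℕ) + n → (i : ℕ) + n ≤ (t : ℕ) + l → y i = z i) :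
    c.Fires l k t y ↔ c.Fires l k t z := by
  constructor
  · rintro ⟨y', h1, h2⟩
    exact ⟨y', fun i hi hi' => (h i hi hi').symm.trans (h1 i hi hi'), h2⟩
  · rintro ⟨y', h1, h2⟩
    exact ⟨y', fun i hi hi' => (h i hi hi').trans (h1 i hi hi'), h2⟩

theorem fires_stopAt (c : Code X Y n) (l : ℕ) (k : Fin c.numSeed)
    (y : Fin (c.level + n - 1) → Y) : c.Fires l k (c.stopAt k y) y :=
  ⟨y, fun _ _ _ => rfl, rfl⟩

theorem HasWindowStopping.stopAt_eq {c : Code X Y n} {l : ℕ} (hw : c.HasWindowStopping l)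
    {k : Fin c.numSeed} {t : Fin (c.level + n - 1)} {y : Fin (c.level + n - 1) → Y}
    (hf : c.Fires l k t y) (ht : t ≤ c.stopAt k y) : c.stopAt k y = t := by
  obtain ⟨y', h1, h2⟩ := hf
  exact (hw k t y y' ht h2.ge h1).2 h2

/-- A window firing earlier would already have stopped the decoder. Thus the event covers actual
stopping, yet it is expressed through windows alone. -/
theorem HasWindowStopping.firesAfterSilence {c : Code X Y n} {l v : ℕ}
    (hw : c.HasWindowStopping l) (hv : 0 < v) (k : Fin c.numSeed)
    (y : Fin (c.level + n - 1) → Y) : c.FiresAfterSilence l v k (c.stopAt k y) y := by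
  refine ⟨c.fires_stopAt l k y, fun t' ht' hf => ?_⟩
  have h := hw.stopAt_eq hf (Fin.le_def.2 (by omega))
  rw [h] at ht'
  omega

/-- The event can occur at no more than `v` times for a given output sequence, all within `v` of the
actual stop. -/
theorem HasWindowStopping.stopAt_le_of_firesAfterSilence {c : Code X Y n} {l v : ℕ}
    (hw : c.HasWindowStopping l) {k : Fin c.numSeed} {t : Fin (c.level + n - 1)}
    {y : Fin (c.level + n - 1) → Y} (h : c.FiresAfterSilence l v k t y) :
    (c.stopAt k y : ℕ) ≤ t ∧ (t : ℕ) < c.stopAt k y + v := by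
  constructor
  · by_contra! hlt
    have := hw.stopAt_eq h.1 (Fin.le_def.2 hlt.le)
    rw [this] at hlt
    omega
  · by_contra! hle
    exact h.2 _ hle (c.fires_stopAt l k y)

theorem firesAfterSilence_congr (c : Code X Y n) {l v : ℕ} {k : Fin c.numSeed}
    {t : Fin (c.level + n - 1)} {y z : Fin (c.level + n - 1) → Y}
    (h : ∀ i : Fin (c.level + n - 1), ∀ t' : Fin (c.level + n - 1), (t' = t ∨ (t' : ℕ) + v ≤ t) →
      (t' : ℕ) + 1 ≤ (i : ℕ) + n → (i : ℕ) + n ≤ (t' : ℕ) + l → y i = z i) :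
    c.FiresAfterSilence l v k t y ↔ c.FiresAfterSilence l v k t z := by
  refine and_congr (c.fires_congr fun i => h i t (Or.inl rfl)) (forall_congr' fun t' => ?_)
  refine imp_congr_right fun ht' => not_congr (c.fires_congr fun i => h i t' (Or.inr ht'))

theorem input_of_lt (c : Code X Y n) (star : X) (m : Fin c.numMsg) {s : Fin c.level}
    {i : Fin (c.level + n - 1)} (h : (i : ℕ) < s) : c.input star m s i = star := by
  rw [input, dif_neg (by omega)]

theorem HasCommonPreamble.input_eq {c : Code X Y n} {l : ℕ} (hc : c.HasCommonPreamble l)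
    (star : X) (m m' : Fin c.numMsg) {s : Fin c.level} {i : Fin (c.level + n - 1)}
    (h : ¬ ((s : ℕ) + l ≤ i ∧ (i : ℕ) < s + n)) : c.input star m s i = c.input star m' s i := by
  unfold input
  split_ifs with h1
  · exact hc _ _ _ (by simp only; omega)
  · rfl

theorem stopAt_decoded_congr (c : Code X Y n) {k : Fin c.numSeed}
    {y y' : Fin (c.level + n - 1) → Y} (h : ∀ i, i ≤ c.stopAt k y → y' i = y i) :
    c.stopAt k y' = c.stopAt k y ∧ c.decoded k y' = c.decoded k y := by
  have h1 := c.stopAt_adapted k y y' h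
  refine ⟨h1, ?_⟩
  unfold decoded
  have : ∀ (t t' : Fin (c.level + n - 1)) (_ : t' = t) (z z' : Fin (c.level + n - 1) → Y)
      (_ : ∀ i, i ≤ t → z' i = z i),
      c.decisionRule t' (fun i => z' ⟨i, lt_of_lt_of_le i.isLt t'.isLt⟩) =
      c.decisionRule t (fun i => z ⟨i, lt_of_lt_of_le i.isLt t.isLt⟩) := by
    rintro t _ rfl z z' hz
    congr 1
    ext i
    exact hz _ (Fin.le_def.2 (Nat.lt_succ_iff.1 i.isLt))
  exact this _ _ h1 _ _ h

variable [Fintype Y]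

theorem expect_eq (c : Code X Y n) (Q : Channel X Y) (star : X) (m : Fin c.numMsg)
    (s : Fin c.level) (f : Fin c.numSeed → (Fin (c.level + n - 1) → Y) → ℝ) :
    c.expect Q star m s f =
      ∑ k, c.seedProb k * prodExpect (fun i b => Q (c.input star m s i) b) (f k) :=
  rfl

theorem expect_mono (c : Code X Y n) (Q : Channel X Y) (star : X) (m : Fin c.numMsg)
    (s : Fin c.level) {f g : Fin c.numSeed → (Fin (c.level + n - 1) → Y) → ℝ}
    (h : ∀ k y, f k y ≤ g k y) : c.expect Q star m s f ≤ c.expect Q star m s g :=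
  Finset.sum_le_sum fun k _ => mul_le_mul_of_nonneg_left
    (prodExpect_mono (fun i b => stdSimplex.zero_le (Q (c.input star m s i)) b) (h k))
    (c.seedProb_nonneg k)

theorem expect_add (c : Code X Y n) (Q : Channel X Y) (star : X) (m : Fin c.numMsg)
    (s : Fin c.level) (f g : Fin c.numSeed → (Fin (c.level + n - 1) → Y) → ℝ) :
    c.expect Q star m s (fun k y => f k y + g k y) =
      c.expect Q star m s f + c.expect Q star m s g := by
  simp only [expect_eq, prodExpect_add, mul_add, Finset.sum_add_distrib]

theorem expect_mul_left (c : Code X Y n) (Q : Channel X Y) (star : X) (m : Fin c.numMsg)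
    (s : Fin c.level) (a : ℝ) (f : Fin c.numSeed → (Fin (c.level + n - 1) → Y) → ℝ) :
    c.expect Q star m s (fun k y => a * f k y) = a * c.expect Q star m s f := by
  simp only [expect_eq, prodExpect_mul_left, Finset.mul_sum]
  exact Finset.sum_congr rfl fun k _ => by ring

theorem expect_const (c : Code X Y n) (Q : Channel X Y) (star : X) (m : Fin c.numMsg)
    (s : Fin c.level) (a : ℝ) : c.expect Q star m s (fun _ _ => a) = a := by
  simp only [expect_eq]
  have h : prodExpect (fun i b => Q (c.input star m s i) b) (fun _ => a) = a :=
    prodExpect_const (fun i => stdSimplex.sum_eq_one (Q (c.input star m s i))) a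
  rw [h, ← Finset.sum_mul, c.seedProb_sum, one_mul]

theorem avg_error_le_errorProb (c : Code X Y n) (Q : Channel X Y) (star : X)
    (m : Fin c.numMsg) :
    ∑ s, c.expect Q star m s (fun k y => if c.decoded k y ≠ m then 1 else 0) ≤
      c.level * c.errorProb Q star := by
  have h := le_ciSup (f := fun m => (1 / (c.level : ℝ)) * ∑ s, c.expect Q star m s fun k y =>
    if c.decoded k y ≠ m then 1 else 0) (Set.finite_range _).bddAbove m
  have hA : (0 : ℝ) < c.level := by exact_mod_cast c.one_le_level
  unfold errorProb
  rwa [one_div, inv_mul_le_iff₀ hA, ← one_div] at h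

theorem avg_delay_le_delay (c : Code X Y n) (Q : Channel X Y) (star : X)
    (m : Fin c.numMsg) :
    ∑ s, c.expect Q star m s (fun k y => (((c.stopAt k y : ℕ) - (s : ℕ) : ℕ) : ℝ)) ≤
      c.level * c.delay Q star := by
  have h := le_ciSup (f := fun m => (1 / (c.level : ℝ)) * ∑ s, c.expect Q star m s fun k y =>
    (((c.stopAt k y : ℕ) - (s : ℕ) : ℕ) : ℝ)) (Set.finite_range _).bddAbove m
  have hA : (0 : ℝ) < c.level := by exact_mod_cast c.one_le_level
  unfold delay
  rwa [one_div, inv_mul_le_iff₀ hA, ← one_div] at h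

/-! ### Converse for a single code: delay and Fano bounds. -/

section Converse

open Classical in
/-- Change of measure: the probability that a sliding-window decoder stops at a time `t` at which
its window contains at most `v` outputs of the codeword. -/
theorem HasWindowStopping.prodExpect_stopAt_eq_le {c : Code X Y n} {l v : ℕ}
    (hw : c.HasWindowStopping l) (hv : 0 < v) {Q : Channel X Y} {star : X} {K : ℝ} (hK1 : 1 ≤ K)
    (hK : ∀ x y, Q x y ≤ K * Q star y) (m : Fin c.numMsg) (s : Fin c.level)
    (k : Fin c.numSeed) (t : Fin (c.level + n - 1)) (ht : (t : ℕ) + l + 1 ≤ s + n + v) :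
    prodExpect (fun i b => Q (c.input star m s i) b)
        (fun y => if c.stopAt k y = t then 1 else 0) ≤
      K ^ v * prodExpect (fun _ b => Q star b)
        (fun y => if c.FiresAfterSilence l v k t y then 1 else 0) := by
  -- The event sees only the window at `t` and windows ending before the transmission. Resetting
  -- every other position to noise leaves at most `v` codeword positions, namely those in `[s, s +
  -- v)`, each costing a factor `K`.
  set p' : Fin (c.level + n - 1) → Y → ℝ := fun i b =>
    Q (if (s : ℕ) ≤ i ∧ (i : ℕ) + n ≤ t + l then c.input star m s i else star) b with hp'
  have h1 : prodExpect (fun i b => Q (c.input star m s i) b)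
      (fun y => if c.stopAt k y = t then 1 else 0) ≤
      prodExpect (fun i b => Q (c.input star m s i) b)
        (fun y => if c.FiresAfterSilence l v k t y then 1 else 0) := by
    refine prodExpect_mono (fun i b => stdSimplex.zero_le (Q _) b) fun y => ?_
    by_cases h : c.stopAt k y = t
    · rw [if_pos h, if_pos (h ▸ hw.firesAfterSilence hv k y)]
    · rw [if_neg h]
      split_ifs <;> norm_num
  have h2 : prodExpect (fun i b => Q (c.input star m s i) b)
        (fun y => if c.FiresAfterSilence l v k t y then (1 : ℝ) else 0) =
      prodExpect p' (fun y => if c.FiresAfterSilence l v k t y then 1 else 0) := by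
    refine prodExpect_congr_of_dependsOn (fun i => stdSimplex.sum_eq_one (Q _))
      (fun i => stdSimplex.sum_eq_one (Q _))
      (fun i : Fin (c.level + n - 1) => ∃ t' : Fin (c.level + n - 1), (t' = t ∨ (t' : ℕ) + v ≤ t) ∧
        (t' : ℕ) + 1 ≤ (i : ℕ) + n ∧ (i : ℕ) + n ≤ (t' : ℕ) + l) ?_ ?_
    · rintro i ⟨t', h, h3, h4⟩
      ext b
      change Q _ b = Q (if (s : ℕ) ≤ i ∧ (i : ℕ) + n ≤ t + l then _ else star) b
      by_cases hs : (s : ℕ) ≤ i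
      · rcases h with rfl | h
        · rw [if_pos ⟨hs, h4⟩]
        · omega
      · rw [if_neg (by omega), c.input_of_lt star m (not_le.1 hs)]
    · intro y z hyz
      have hiff := c.firesAfterSilence_congr (k := k) (t := t) (v := v) (l := l)
        fun i t' h h3 h4 => hyz i ⟨t', h, h3, h4⟩
      by_cases hy : c.FiresAfterSilence l v k t y
      · rw [if_pos hy, if_pos (hiff.1 hy)]
      · rw [if_neg hy, if_neg fun hz => hy (hiff.2 hz)]
  have h3 : ∀ y : Fin (c.level + n - 1) → Y,
      ∏ i, p' i (y i) ≤ K ^ v * ∏ i, Q star (y i) := by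
    intro y
    calc ∏ i, p' i (y i) ≤ ∏ i : Fin (c.level + n - 1),
          (if (s : ℕ) ≤ i ∧ (i : ℕ) + n ≤ t + l then K else 1) * Q star (y i) := by
          refine Finset.prod_le_prod (fun i _ => stdSimplex.zero_le (Q _) _) fun i _ => ?_
          simp only [hp']
          split_ifs
          · exact hK _ _
          · rw [one_mul]
      _ = K ^ (Finset.univ.filter fun i : Fin (c.level + n - 1) =>
            (s : ℕ) ≤ i ∧ (i : ℕ) + n ≤ t + l).card * ∏ i, Q star (y i) := by
          rw [Finset.prod_mul_distrib, Finset.prod_ite]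
          simp
      _ ≤ _ := by
          refine mul_le_mul_of_nonneg_right (pow_le_pow_right₀ hK1 ?_)
            (Finset.prod_nonneg fun i _ => stdSimplex.zero_le (Q star) _)
          exact card_fin_filter_le s (s + v) v _ (fun i hi => ⟨hi.1, by omega⟩) le_rfl
  refine h1.trans (h2.trans_le ?_)
  rw [prodExpect, prodExpect, Finset.mul_sum]
  refine Finset.sum_le_sum fun y _ => ?_
  rw [← mul_assoc]
  refine mul_le_mul_of_nonneg_right (h3 y) ?_
  split_ifs <;> norm_num

/-- A sliding-window decoder whose window contains too little of the preamble stops during the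
transmission only with small probability, for otherwise it would have stopped before. -/
theorem HasWindowStopping.sum_expect_stopAt_lt_le {c : Code X Y n} {l v w : ℕ}
    (hw : c.HasWindowStopping l) (hv : 0 < v) {Q : Channel X Y} {star : X} {K : ℝ} (hK1 : 1 ≤ K)
    (hK : ∀ x y, Q x y ≤ K * Q star y) (hwv : w + l ≤ n + v) (m : Fin c.numMsg) :
    ∑ s : Fin c.level, c.expect Q star m s (fun k y =>
      if (s : ℕ) ≤ c.stopAt k y ∧ (c.stopAt k y : ℕ) < s + w then 1 else 0) ≤
      w * v * K ^ v := by
  classical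
  have hfix : ∀ k, ∑ s : Fin c.level, prodExpect (fun i b => Q (c.input star m s i) b) (fun y =>
      if (s : ℕ) ≤ c.stopAt k y ∧ (c.stopAt k y : ℕ) < s + w then 1 else 0) ≤
      w * v * K ^ v := by
    intro k
    set F : Fin (c.level + n - 1) → ℝ := fun t => prodExpect (fun _ b => Q star b)
        (fun y => if c.FiresAfterSilence l v k t y then 1 else 0) with hF
    have hF0 : ∀ t, 0 ≤ F t := fun t =>
      prodExpect_nonneg (fun _ b => stdSimplex.zero_le (Q star) b)
        fun y => by split_ifs <;> norm_num
    -- The law under `F` is pure noise, independent of `s`, so one bound on the expected number of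
    -- firing times serves all starting times. Each `t` is then charged by at most `w` of them.
    have hFsum : ∑ t, F t ≤ v := by
      rw [hF, ← prodExpect_sum]
      refine (prodExpect_mono (fun _ b => stdSimplex.zero_le (Q star) b)
        (g := fun _ => (v : ℝ)) fun y => ?_).trans_eq
          (prodExpect_const (fun _ => stdSimplex.sum_eq_one (Q star)) _)
      rw [Finset.sum_boole]
      exact_mod_cast card_fin_filter_le (c.stopAt k y) (c.stopAt k y + v) v _
        (fun t ht => hw.stopAt_le_of_firesAfterSilence ht) le_rfl
    calc _ ≤ ∑ s : Fin c.level, ∑ t : Fin (c.level + n - 1),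
          if (s : ℕ) ≤ t ∧ (t : ℕ) < s + w then K ^ v * F t else 0 := by
          refine Finset.sum_le_sum fun s _ => ?_
          have hdec : ∀ y, (if (s : ℕ) ≤ c.stopAt k y ∧ (c.stopAt k y : ℕ) < s + w
              then (1 : ℝ) else 0) = ∑ t : Fin (c.level + n - 1),
              (if (s : ℕ) ≤ t ∧ (t : ℕ) < s + w then (1 : ℝ) else 0) *
                (if c.stopAt k y = t then 1 else 0) := by
            intro y
            simp
          simp_rw [hdec]
          rw [prodExpect_sum]
          refine Finset.sum_le_sum fun t _ => ?_
          rw [prodExpect_mul_left]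
          by_cases h : (s : ℕ) ≤ t ∧ (t : ℕ) < s + w
          · rw [if_pos h, if_pos h, one_mul]
            exact hw.prodExpect_stopAt_eq_le hv hK1 hK m s k t (by omega)
          · rw [if_neg h, if_neg h, zero_mul]
      _ = ∑ t : Fin (c.level + n - 1), ((Finset.univ.filter fun s : Fin c.level =>
            (s : ℕ) ≤ t ∧ (t : ℕ) < s + w).card : ℝ) * (K ^ v * F t) := by
          rw [Finset.sum_comm]
          refine Finset.sum_congr rfl fun t _ => ?_
          rw [← Finset.sum_filter, Finset.sum_const, nsmul_eq_mul]
      _ ≤ ∑ t : Fin (c.level + n - 1), (w : ℝ) * (K ^ v * F t) := by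
          refine Finset.sum_le_sum fun t _ => mul_le_mul_of_nonneg_right ?_
            (mul_nonneg (by positivity) (hF0 t))
          exact_mod_cast card_fin_filter_le (t + 1 - w) (t + 1) w _
            (fun s hs => ⟨by omega, by omega⟩) (by omega)
      _ = w * K ^ v * ∑ t, F t := by
          rw [Finset.mul_sum]
          exact Finset.sum_congr rfl fun t _ => by ring
      _ ≤ w * K ^ v * v := by gcongr
      _ = _ := by ring
  simp_rw [expect_eq]
  rw [Finset.sum_comm]
  calc _ ≤ ∑ k, c.seedProb k * (w * v * K ^ v) := by
        refine Finset.sum_le_sum fun k _ => ?_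
        rw [← Finset.mul_sum]
        exact mul_le_mul_of_nonneg_left (hfix k) (c.seedProb_nonneg k)
    _ = _ := by rw [← Finset.sum_mul, c.seedProb_sum, one_mul]

/-- A decoder that stops before the transmission can only guess the message. -/
theorem sum_expect_lt_start_le (c : Code X Y n) (Q : Channel X Y) (star : X)
    (m : Fin c.numMsg) :
    ∑ s : Fin c.level, c.expect Q star m s (fun k y =>
      if (c.stopAt k y : ℕ) < s then 1 else 0) ≤ 2 * (c.level * c.errorProb Q star) := by
  have hone : ∀ x, ∑ b, Q x b = 1 := fun x => stdSimplex.sum_eq_one (Q x)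
  have hM : (2 : ℝ) ≤ c.numMsg := by exact_mod_cast c.two_le_numMsg
  -- Before the start only noise is seen, so the declared message has the same law whichever message
  -- is sent. It is wrong for all but one of them. The factor 2 in the result bounds `M / (M - 1)`.
  have hfix : ∀ (s : Fin c.level) (k : Fin c.numSeed), ((c.numMsg : ℝ) - 1) *
      prodExpect (fun i b => Q (c.input star m s i) b)
        (fun y => if (c.stopAt k y : ℕ) < s then 1 else 0) ≤
      ∑ m', prodExpect (fun i b => Q (c.input star m' s i) b)
        (fun y => if c.decoded k y ≠ m' then 1 else 0) := by
    intro s k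
    have hearly : ∀ (m' : Fin c.numMsg) (f : Fin c.numMsg → ℝ),
        prodExpect (fun i b => Q (c.input star m' s i) b)
          (fun y => if (c.stopAt k y : ℕ) < s then f (c.decoded k y) else 0) =
        prodExpect (fun _ b => Q star b)
          (fun y => if (c.stopAt k y : ℕ) < s then f (c.decoded k y) else 0) := by
      intro m' f
      refine prodExpect_congr_of_dependsOn (fun i => hone _) (fun i => hone _)
        (fun i : Fin (c.level + n - 1) => (i : ℕ) < s) (fun i hi => by rw [c.input_of_lt star m' hi]) ?_
      intro y z hyz
      by_cases h : (c.stopAt k y : ℕ) < s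
      · obtain ⟨h1, h2⟩ := c.stopAt_decoded_congr (k := k) (y := y) (y' := z)
          fun i hi => (hyz i (by have := Fin.le_def.1 hi; omega)).symm
        rw [h1, h2]
      · have h' : ¬ (c.stopAt k z : ℕ) < s := fun h' => by
          obtain ⟨h1, h2⟩ := c.stopAt_decoded_congr (k := k) (y := z) (y' := y)
            fun i hi => hyz i (by have := Fin.le_def.1 hi; omega)
          rw [h1] at h
          exact h h'
        rw [if_neg h, if_neg h']
    calc _ = ((c.numMsg : ℝ) - 1) * prodExpect (fun _ b => Q star b)
          (fun y => if (c.stopAt k y : ℕ) < s then 1 else 0) := by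
          rw [hearly m (fun _ => 1)]
      _ = ∑ m', prodExpect (fun _ b => Q star b) (fun y => if (c.stopAt k y : ℕ) < s then
            (if c.decoded k y ≠ m' then 1 else 0) else 0) := by
          rw [← prodExpect_sum, ← prodExpect_mul_left]
          congr 1
          ext y
          by_cases h : (c.stopAt k y : ℕ) < s
          · simp only [if_pos h, mul_one]
            have : ∀ m', (if c.decoded k y ≠ m' then (1 : ℝ) else 0) =
                1 - if c.decoded k y = m' then 1 else 0 := by
              intro m'
              by_cases h : c.decoded k y = m' <;> simp [h]
            simp_rw [this]
            simp
          · simp [h]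
      _ = ∑ m', prodExpect (fun i b => Q (c.input star m' s i) b)
            (fun y => if (c.stopAt k y : ℕ) < s then
              (if c.decoded k y ≠ m' then 1 else 0) else 0) :=
          Finset.sum_congr rfl fun m' _ =>
            (hearly m' (fun d => if d ≠ m' then 1 else 0)).symm
      _ ≤ _ := by
          refine Finset.sum_le_sum fun m' _ =>
            prodExpect_mono (fun i b => stdSimplex.zero_le (Q _) b) fun y => ?_
          by_cases h : (c.stopAt k y : ℕ) < s
          · rw [if_pos h]
          · rw [if_neg h]
            split_ifs <;> norm_num
  have hsum : ((c.numMsg : ℝ) - 1) * ∑ s : Fin c.level, c.expect Q star m s (fun k y =>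
      if (c.stopAt k y : ℕ) < s then 1 else 0) ≤
      ∑ m', ∑ s, c.expect Q star m' s (fun k y => if c.decoded k y ≠ m' then 1 else 0) := by
    rw [Finset.sum_comm, Finset.mul_sum]
    refine Finset.sum_le_sum fun s _ => ?_
    simp_rw [expect_eq]
    rw [Finset.sum_comm, Finset.mul_sum]
    refine Finset.sum_le_sum fun k _ => ?_
    rw [← Finset.mul_sum, mul_left_comm]
    exact mul_le_mul_of_nonneg_left (hfix s k) (c.seedProb_nonneg k)
  have hle : ∑ m', ∑ s, c.expect Q star m' s (fun k y => if c.decoded k y ≠ m' then 1 else 0) ≤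
      c.numMsg * (c.level * c.errorProb Q star) := by
    refine (Finset.sum_le_sum fun m' _ => c.avg_error_le_errorProb Q star m').trans_eq ?_
    simp
  have h0 : 0 ≤ c.level * c.errorProb Q star := by
    refine le_trans (Finset.sum_nonneg fun s _ => ?_) (c.avg_error_le_errorProb Q star m)
    refine (c.expect_const Q star m s 0).symm.trans_le ?_
    exact c.expect_mono Q star m s fun k y => by split_ifs <;> norm_num
  have h2 := hsum.trans hle
  set B := ∑ s : Fin c.level, c.expect Q star m s (fun k y =>
      if (c.stopAt k y : ℕ) < s then 1 else 0)
  by_contra! hlt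
  nlinarith

/-- The delay is at least `w` unless the decoder stops before the start, which costs errors, or
within `w` of it, which the window cannot justify. -/
theorem HasWindowStopping.le_delay {c : Code X Y n} {l v w : ℕ}
    (hw : c.HasWindowStopping l) (hv : 0 < v) {Q : Channel X Y} {star : X} {K : ℝ} (hK1 : 1 ≤ K)
    (hK : ∀ x y, Q x y ≤ K * Q star y) (hwv : w + l ≤ n + v) :
    w * (1 - 2 * c.errorProb Q star - w * v * K ^ v / c.level) ≤ c.delay Q star := by
  have hA : (0 : ℝ) < c.level := by exact_mod_cast c.one_le_level
  have m : Fin c.numMsg := ⟨0, by have := c.two_le_numMsg; omega⟩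
  have h1 := c.avg_delay_le_delay Q star m
  have h2 := c.sum_expect_lt_start_le Q star m
  have h3 := hw.sum_expect_stopAt_lt_le hv hK1 hK hwv m (star := star)
  have h4 : ∑ s : Fin c.level, (w * (1 + (-1) * (c.expect Q star m s (fun k y =>
        if (c.stopAt k y : ℕ) < s then 1 else 0) + c.expect Q star m s (fun k y =>
      if (s : ℕ) ≤ c.stopAt k y ∧ (c.stopAt k y : ℕ) < s + w then 1 else 0))) : ℝ) ≤
      ∑ s, c.expect Q star m s (fun k y => (((c.stopAt k y : ℕ) - (s : ℕ) : ℕ) : ℝ)) := by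
    refine Finset.sum_le_sum fun s _ => ?_
    rw [← expect_add, ← expect_mul_left]
    nth_rewrite 1 [← c.expect_const Q star m s 1]
    rw [← expect_add, ← expect_mul_left]
    refine c.expect_mono Q star m s fun k y => ?_
    by_cases ha : (c.stopAt k y : ℕ) < s
    · rw [if_pos ha, if_neg (by omega)]
      simp
    · by_cases hb : (c.stopAt k y : ℕ) < s + w
      · rw [if_neg ha, if_pos ⟨by omega, hb⟩]
        simp
      · rw [if_neg ha, if_neg (by omega)]
        have : w ≤ (c.stopAt k y : ℕ) - (s : ℕ) := by omega
        simpa using this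
  rw [← Finset.mul_sum, Finset.sum_add_distrib, ← Finset.mul_sum, Finset.sum_add_distrib] at h4
  simp only [Finset.sum_const, Finset.card_univ, Fintype.card_fin, nsmul_eq_mul, mul_one] at h4
  have h5 := h4.trans h1
  have hw0 : (0 : ℝ) ≤ w := Nat.cast_nonneg w
  have h6 : (w : ℝ) * (c.level + (-1) * (2 * (c.level * c.errorProb Q star) + w * v * K ^ v)) ≤
      c.level * c.delay Q star := by
    refine le_trans (mul_le_mul_of_nonneg_left ?_ hw0) h5
    linarith
  have h7 : c.level * (w * (1 - 2 * c.errorProb Q star - w * v * K ^ v / c.level)) =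
      (w : ℝ) * (c.level + (-1) * (2 * (c.level * c.errorProb Q star) + w * v * K ^ v)) := by
    field_simp
    ring
  rw [← h7] at h6
  exact le_of_mul_le_mul_left h6 hA

/-- Fano's inequality for codewords with a common preamble. -/
theorem HasCommonPreamble.log_numMsg_le [Fintype X] {c : Code X Y n} {l : ℕ}
    (hc : c.HasCommonPreamble l) (hl : l ≤ n) {Q : Channel X Y} (star : X) {q : Y → ℝ}
    (hq : ∀ y, 0 < q y) {C : ℝ} (hC : 0 ≤ C)
    (hQ : ∀ x, ∑ y, Q x y * Real.log (Q x y / q y) ≤ C) (hq1 : ∑ y, q y = 1) :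
    (1 - c.errorProb Q star) * Real.log c.numMsg ≤ C * (n - l) + Real.log 2 := by
  have hA : (0 : ℝ) < c.level := by exact_mod_cast c.one_le_level
  have hM : (2 : ℝ) ≤ c.numMsg := by exact_mod_cast c.two_le_numMsg
  have hM0 : (0 : ℝ) < c.numMsg := by linarith
  have hlog : 0 ≤ Real.log c.numMsg := Real.log_nonneg (by linarith)
  set m₀ : Fin c.numMsg := ⟨0, by have := c.two_le_numMsg; omega⟩
  set B : ℝ := C * (n - l) + Real.log 2 with hB
  have hfix : ∀ (s : Fin c.level) (k : Fin c.numSeed),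
      ∑ m, prodExpect (fun i b => Q (c.input star m s i) b)
        (fun y => Real.log c.numMsg * if c.decoded k y = m then 1 else 0) ≤ c.numMsg * B := by
    intro s k
    -- The reference law puts `q` on the positions after the preamble. By the common preamble it
    -- does not depend on the message, and its divergence from the true law is at most `C (n - l)`.
    set p' : Fin (c.level + n - 1) → Y → ℝ := fun i b =>
      if (s : ℕ) + l ≤ i ∧ (i : ℕ) < s + n then q b else Q (c.input star m₀ s i) b with hp'
    have hp'0 : ∀ i b, 0 ≤ p' i b := fun i b => by
      simp only [hp']
      split_ifs
      · exact (hq b).le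
      · exact stdSimplex.zero_le (Q _) b
    have hp'1 : ∀ i, ∑ b, p' i b = 1 := fun i => by
      by_cases h : (s : ℕ) + l ≤ i ∧ (i : ℕ) < s + n
      · simp only [hp', if_pos h, hq1]
      · simp only [hp', if_neg h]
        exact stdSimplex.sum_eq_one (Q _)
    have hm : ∀ m, prodExpect (fun i b => Q (c.input star m s i) b)
        (fun y => Real.log c.numMsg * if c.decoded k y = m then 1 else 0) ≤
        B - 1 + (1 + (c.numMsg - 1) *
          prodExpect p' (fun y => if c.decoded k y = m then 1 else 0)) / 2 := by
      intro m
      -- With `a = 2`, the exponential moments summed over `m` total `2M - 1`; half of this is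
      -- absorbed by the `-1` of each message, leaving only `ln 2` per message.
      have h1 := prodExpect_le_divergence (p := fun i b => Q (c.input star m s i) b) (p' := p')
        (fun i b => stdSimplex.zero_le (Q _) b) hp'0 (fun i => stdSimplex.sum_eq_one (Q _))
        (fun i b hb => by
          by_cases h : (s : ℕ) + l ≤ i ∧ (i : ℕ) < s + n
          · simp only [hp', if_pos h, hq]
          · simp only [hp', if_neg h]
            rwa [← hc.input_eq star m m₀ h])
        (fun y => Real.log c.numMsg * if c.decoded k y = m then 1 else 0) two_pos
      have h2 : ∑ i, ∑ b, Q (c.input star m s i) b *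
          Real.log (Q (c.input star m s i) b / p' i b) ≤ C * (n - l) := by
        calc _ ≤ ∑ i : Fin (c.level + n - 1),
              (if (s : ℕ) + l ≤ i ∧ (i : ℕ) < s + n then C else 0) := by
              refine Finset.sum_le_sum fun i _ => ?_
              by_cases h : (s : ℕ) + l ≤ i ∧ (i : ℕ) < s + n
              · simp only [hp', if_pos h]
                exact hQ _
              · simp only [hp', if_neg h]
                rw [hc.input_eq star m m₀ h]
                refine (Finset.sum_eq_zero fun b _ => ?_).le
                by_cases hb : Q (c.input star m₀ s i) b = 0 <;> simp [hb]
          _ = ((Finset.univ.filter fun i : Fin (c.level + n - 1) =>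
                (s : ℕ) + l ≤ i ∧ (i : ℕ) < s + n).card : ℝ) * C := by
              rw [← Finset.sum_filter, Finset.sum_const, nsmul_eq_mul]
          _ ≤ ((n - l : ℕ) : ℝ) * C := by
              refine mul_le_mul_of_nonneg_right ?_ hC
              exact_mod_cast card_fin_filter_le (s + l) (s + n) (n - l) _ (fun i hi => hi)
                (by omega)
          _ = _ := by rw [Nat.cast_sub hl]; ring
      have h3 : prodExpect p' (fun y => Real.exp
          (Real.log c.numMsg * if c.decoded k y = m then 1 else 0)) =
          1 + (c.numMsg - 1) * prodExpect p' (fun y => if c.decoded k y = m then 1 else 0) := by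
        rw [← prodExpect_mul_left]
        refine Eq.trans ?_ (congrArg (· + _) (prodExpect_one hp'1))
        rw [← prodExpect_add]
        congr 1
        ext y
        by_cases h : c.decoded k y = m
        · simp [h, Real.exp_log hM0]
        · simp [h]
      rw [h3] at h1
      linarith
    have h4 : ∑ m, prodExpect p' (fun y => if c.decoded k y = m then (1 : ℝ) else 0) = 1 := by
      rw [← prodExpect_sum]
      simpa using prodExpect_one hp'1
    refine (Finset.sum_le_sum fun m _ => hm m).trans ?_
    rw [Finset.sum_add_distrib, ← Finset.sum_div, Finset.sum_add_distrib, ← Finset.mul_sum, h4]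
    simp only [Finset.sum_const, Finset.card_univ, Fintype.card_fin, nsmul_eq_mul, mul_one]
    linarith
  have hsum : ∑ m, ∑ s, c.expect Q star m s
      (fun k y => Real.log c.numMsg * if c.decoded k y = m then 1 else 0) ≤
      c.level * (c.numMsg * B) := by
    rw [Finset.sum_comm]
    have : ∀ s : Fin c.level, ∑ m, c.expect Q star m s
        (fun k y => Real.log c.numMsg * if c.decoded k y = m then 1 else 0) ≤ c.numMsg * B := by
      intro s
      simp_rw [expect_eq]
      rw [Finset.sum_comm]
      calc _ ≤ ∑ k, c.seedProb k * (c.numMsg * B) := by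
            refine Finset.sum_le_sum fun k _ => ?_
            rw [← Finset.mul_sum]
            exact mul_le_mul_of_nonneg_left (hfix s k) (c.seedProb_nonneg k)
        _ = _ := by rw [← Finset.sum_mul, c.seedProb_sum, one_mul]
    refine (Finset.sum_le_sum fun s _ => this s).trans_eq ?_
    simp
  have hcorr : ∀ m, c.level * (1 - c.errorProb Q star) * Real.log c.numMsg ≤
      ∑ s, c.expect Q star m s
        (fun k y => Real.log c.numMsg * if c.decoded k y = m then 1 else 0) := by
    intro m
    have h1 := c.avg_error_le_errorProb Q star m
    have h2 : ∀ s, c.expect Q star m s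
        (fun k y => Real.log c.numMsg * if c.decoded k y = m then 1 else 0) =
        Real.log c.numMsg * (1 + (-1) * c.expect Q star m s
          (fun k y => if c.decoded k y ≠ m then 1 else 0)) := by
      intro s
      have e1 : ∀ g, 1 + c.expect Q star m s g = c.expect Q star m s (fun k y => 1 + g k y) :=
        fun g => by rw [expect_add, expect_const]
      rw [expect_mul_left, ← expect_mul_left c Q star m s (-1), e1]
      congr 2
      ext k y
      by_cases h : c.decoded k y = m <;> simp [h]
    simp_rw [h2]
    rw [← Finset.mul_sum, Finset.sum_add_distrib, ← Finset.mul_sum]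
    simp only [Finset.sum_const, Finset.card_univ, Fintype.card_fin, nsmul_eq_mul, mul_one]
    rw [mul_comm _ (Real.log _)]
    refine mul_le_mul_of_nonneg_left ?_ hlog
    linarith
  have h5 := (Finset.sum_le_sum fun m (_ : m ∈ Finset.univ) => hcorr m).trans hsum
  simp only [Finset.sum_const, Finset.card_univ, Fintype.card_fin, nsmul_eq_mul] at h5
  have h6 : ((c.numMsg : ℝ) * c.level) * ((1 - c.errorProb Q star) * Real.log c.numMsg) ≤
      ((c.numMsg : ℝ) * c.level) * B := by linarith
  exact le_of_mul_le_mul_left h6 (by positivity)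

end Converse

end Code

/-! ### Asymptotic converse for training-based schemes. -/

section TrainingBased

variable {X Y : Type*} [Fintype Y]

theorem Code.mul_delay_le_log_numMsg {n : ℕ} {c : Code X Y n} {Q : Channel X Y} {star : X} {r : ℝ}
    (hr : ENNReal.ofReal r ≤ c.rate Q star) (hd : 0 < c.delay Q star) :
    r * c.delay Q star ≤ Real.log c.numMsg := by
  have hM : (1 : ℝ) ≤ c.numMsg := by
    have := c.two_le_numMsg
    exact_mod_cast (by omega : 1 ≤ c.numMsg)
  rw [Code.rate, ← ENNReal.ofReal_div_of_pos hd,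
    ENNReal.ofReal_le_ofReal_iff (div_nonneg (Real.log_nonneg hM) hd.le)] at hr
  exact (le_div_iff₀ hd).1 hr

/-- A training-based scheme of rate `R` and asynchronism exponent `α` has to spend a positive
fraction of its block on the detection of the preamble. -/
theorem IsTrainingBased.mul_le [Fintype X] {S : (n : ℕ) → Code X Y n} (hS : IsTrainingBased S)
    {Q : Channel X Y} {star : X} {R α : ℝ} (hach : Achieves Q star S R α)
    {K : ℝ} (hK1 : 1 < K) (hK : ∀ x y, Q x y ≤ K * Q star y)
    {q : Y → ℝ} (hq : ∀ y, 0 < q y) (hq1 : ∑ y, q y = 1) {C : ℝ}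
    (hQ : ∀ x, ∑ y, Q x y * Real.log (Q x y / q y) ≤ C) (hR : 0 < R) (hRC : R ≤ C)
    {θ : ℝ} (hθ : 0 < θ) (hθα : θ * Real.log K < α) : R * θ ≤ C - R := by
  obtain ⟨η, hη0, hη1, hS⟩ := hS
  by_contra! hlt
  -- The negated claim reads `C < R (1 + θ)`; a small `ε` keeps this strict after all losses: Fano
  -- `1 - ε`, rate `R - ε`, and delay `1 - 3ε` (twice the error plus false alarms).
  have hε : ∀ᶠ ε : ℝ in nhdsWithin 0 (Set.Ioi 0),
      C < (1 - ε) * (R - ε) * (1 - 3 * ε) * (1 + θ) ∧ ε < α - θ * Real.log K ∧ ε < R ∧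
        ε < 1 / 3 ∧ 0 < ε := by
    have hc : Tendsto (fun ε : ℝ => (1 - ε) * (R - ε) * (1 - 3 * ε) * (1 + θ)) (nhds 0)
        (nhds ((1 - 0) * (R - 0) * (1 - 3 * 0) * (1 + θ))) :=
      Continuous.tendsto (by fun_prop) 0
    have h1 := (hc.eventually_const_lt (u := C) (by linarith)).filter_mono
      (nhdsWithin_le_nhds (s := Set.Ioi 0))
    have h2 : ∀ {a : ℝ}, 0 < a → ∀ᶠ ε : ℝ in nhdsWithin 0 (Set.Ioi 0), ε < a := fun ha =>
      (eventually_lt_nhds ha).filter_mono nhdsWithin_le_nhds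
    filter_upwards [h1, h2 (sub_pos.2 hθα), h2 hR, h2 (a := 1 / 3) (by norm_num),
      self_mem_nhdsWithin] with ε a b c d e using ⟨a, b, c, d, e⟩
  obtain ⟨ε, hε1, hε2, hε3, hε4, hε0⟩ := hε.exists
  set ρ : ℝ := (1 - ε) * (R - ε) * (1 - 3 * ε) with hρ
  have hρ0 : 0 < ρ := mul_pos (mul_pos (by linarith) (by linarith)) (by linarith)
  have hρR : ρ ≤ R := by
    have h1 : (1 - ε) * (R - ε) ≤ R := by nlinarith
    have h2 : 0 ≤ (1 - ε) * (R - ε) := mul_nonneg (by linarith) (by linarith)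
    nlinarith
  have hlogK : 0 < Real.log K := Real.log_pos hK1
  -- for large `n`, false alarms before the transmission are almost certain
  have hfa : ∀ᶠ n : ℕ in atTop, θ * (1 + θ) * ((n : ℝ) ^ 2 *
      Real.exp (-(α - ε - θ * Real.log K)) ^ n) < ε := by
    have hlt1 : |Real.exp (-(α - ε - θ * Real.log K))| < 1 := by
      rw [abs_of_pos (Real.exp_pos _), Real.exp_lt_one_iff]
      linarith
    have := (tendsto_pow_const_mul_const_pow_of_abs_lt_one 2 hlt1).const_mul (θ * (1 + θ))
    rw [mul_zero] at this
    exact this.eventually_lt_const hε0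
  have hbig : ∀ᶠ n : ℕ in atTop, (ρ + Real.log 2) < (ρ * (1 + θ) - C) * n := by
    have := (tendsto_natCast_atTop_atTop (R := ℝ)).const_mul_atTop (sub_pos.2 hε1)
    exact this.eventually_gt_atTop _
  have hv1 : ∀ᶠ n : ℕ in atTop, 1 ≤ θ * n := by
    have := (tendsto_natCast_atTop_atTop (R := ℝ)).const_mul_atTop hθ
    exact this.eventually_ge_atTop _
  obtain ⟨n, ⟨hpre, hwin⟩, ⟨⟨hA, -⟩, hrate, herr⟩, hfa, hbig, hv1⟩ :=
    (hS.and ((hach ε hε0).and (hfa.and (hbig.and hv1)))).exists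
  set c := S n with hc
  set l := ⌊η * n⌋₊ with hl
  set v := ⌊θ * n⌋₊ with hv
  have hln : l ≤ n := by
    refine Nat.floor_le_of_le ?_
    have : (0 : ℝ) ≤ n := Nat.cast_nonneg n
    nlinarith
  have hv0 : 0 < v := Nat.floor_pos.2 hv1
  have hvle : (v : ℝ) ≤ θ * n := Nat.floor_le (by linarith)
  have hvge : θ * n < v + 1 := Nat.lt_floor_add_one _
  have hlnR : (l : ℝ) ≤ n := by exact_mod_cast hln
  have hA0 : (0 : ℝ) < c.level := by exact_mod_cast c.one_le_level
  set w : ℕ := n - l + v with hw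
  have hwR : (w : ℝ) = n - l + v := by rw [hw]; push_cast [Nat.cast_sub hln]; ring
  have hdel := hwin.le_delay hv0 hK1.le hK (show w + l ≤ n + v by omega) (star := star)
  have hsmall : w * v * K ^ v / c.level ≤ ε := by
    have hKv : K ^ v ≤ Real.exp (θ * Real.log K) ^ n := by
      rw [← Real.exp_nat_mul, ← Real.exp_log (by linarith : 0 < K), ← Real.exp_nat_mul,
        Real.log_exp]
      refine Real.exp_le_exp.2 ?_
      have := mul_le_mul_of_nonneg_right hvle hlogK.le
      linarith
    have hwle : (w : ℝ) ≤ (1 + θ) * n := by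
      have : (0 : ℝ) ≤ l := Nat.cast_nonneg l
      rw [hwR]; linarith
    have hA' : Real.exp (α - ε) ^ n ≤ c.level := by
      rw [← Real.exp_nat_mul, mul_comm]; exact hA
    calc w * v * K ^ v / c.level
        ≤ ((1 + θ) * n) * (θ * n) * Real.exp (θ * Real.log K) ^ n / Real.exp (α - ε) ^ n := by
          gcongr
      _ = θ * (1 + θ) * ((n : ℝ) ^ 2 * Real.exp (-(α - ε - θ * Real.log K)) ^ n) := by
          have : Real.exp (-(α - ε - θ * Real.log K)) =
              Real.exp (θ * Real.log K) / Real.exp (α - ε) := by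
            rw [← Real.exp_sub]; ring_nf
          rw [this, div_pow]
          ring
      _ ≤ ε := hfa.le
  have hw0 : (0 : ℝ) < w := by exact_mod_cast (by omega : 0 < w)
  have hdel2 : w * (1 - 3 * ε) ≤ c.delay Q star := by
    refine le_trans (mul_le_mul_of_nonneg_left ?_ hw0.le) hdel
    linarith
  have hd0 : 0 < c.delay Q star := lt_of_lt_of_le (mul_pos hw0 (by linarith)) hdel2
  have hM := Code.mul_delay_le_log_numMsg hrate hd0
  have hF := hpre.log_numMsg_le hln star hq (hR.le.trans hRC) hQ hq1
  have hlog0 : 0 ≤ Real.log c.numMsg := le_trans (mul_nonneg (by linarith) hd0.le) hM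
  have h1 : (1 - ε) * Real.log c.numMsg ≤ C * (n - l) + Real.log 2 :=
    (mul_le_mul_of_nonneg_right (by linarith) hlog0).trans hF
  have h2 : ρ * w ≤ (1 - ε) * Real.log c.numMsg := by
    calc ρ * w = (1 - ε) * ((R - ε) * (w * (1 - 3 * ε))) := by rw [hρ]; ring
      _ ≤ (1 - ε) * ((R - ε) * c.delay Q star) :=
          mul_le_mul_of_nonneg_left (mul_le_mul_of_nonneg_left hdel2 (by linarith)) (by linarith)
      _ ≤ _ := mul_le_mul_of_nonneg_left hM (by linarith)
  have h3 : ρ * (n - l + v) ≤ C * (n - l) + Real.log 2 := by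
    rw [← hwR]; exact h2.trans h1
  -- Since `ρ ≤ R ≤ C`, the preamble length drops out: having no preamble is the worst case for this
  -- bound.
  have h4 : (C - ρ) * (n - l) ≤ (C - ρ) * n := by
    refine mul_le_mul_of_nonneg_left ?_ (by linarith)
    have : (0 : ℝ) ≤ l := Nat.cast_nonneg l
    linarith
  have h5 : ρ * (θ * n) ≤ ρ * (v + 1) := mul_le_mul_of_nonneg_left hvge.le hρ0.le
  linarith

/-- A larger `α` would leave room for some `θ` strictly between `(C - R)/R` and `α / ln K`, which
violates `R θ ≤ C - R`. -/
theorem trainingCapacity_le [Fintype X] {Q : Channel X Y} {star : X} {R : ℝ}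
    {K : ℝ} (hK1 : 1 < K) (hK : ∀ x y, Q x y ≤ K * Q star y)
    {q : Y → ℝ} (hq : ∀ y, 0 < q y) (hq1 : ∑ y, q y = 1) {C : ℝ}
    (hQ : ∀ x, ∑ y, Q x y * Real.log (Q x y / q y) ≤ C) (hR : 0 < R) (hRC : R ≤ C) :
    trainingCapacity Q star R ≤ ENNReal.ofReal (Real.log K * ((C - R) / R)) := by
  have hlogK : 0 < Real.log K := Real.log_pos hK1
  refine sSup_le ?_
  rintro _ ⟨α, rfl, S, hS, hach⟩
  rw [← ENNReal.ofReal_coe_nnreal]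
  refine ENNReal.ofReal_le_ofReal ?_
  by_contra! hlt
  have h1 : (C - R) / R < α / Real.log K := by
    rw [lt_div_iff₀ hlogK, mul_comm]
    exact hlt
  obtain ⟨θ, h2, h3⟩ := exists_between h1
  have h4 : 0 ≤ (C - R) / R := div_nonneg (by linarith) hR.le
  have h5 := hS.mul_le hach hK1 hK hq hq1 hQ hR hRC (h4.trans_lt h2)
    ((lt_div_iff₀ hlogK).1 h3)
  rw [div_lt_iff₀ hR] at h2
  linarith

end TrainingBased

/-! ### Further facts on product laws. -/

section ProdExpect

variable {ι Z : Type*} [Fintype ι] [DecidableEq ι] [Fintype Z]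

/-- Needed where logarithms of probabilities appear, which are meaningful only at points of positive
mass. -/
theorem prodExpect_mono_of_pos {p : ι → Z → ℝ} (hp : ∀ i b, 0 ≤ p i b) {f g : (ι → Z) → ℝ}
    (h : ∀ z, (∀ i, 0 < p i (z i)) → f z ≤ g z) : prodExpect p f ≤ prodExpect p g := by
  refine Finset.sum_le_sum fun z _ => ?_
  rcases (Finset.prod_nonneg fun i (_ : i ∈ Finset.univ) => hp i (z i)).eq_or_lt with h0 | h0
  · rw [← h0, zero_mul, zero_mul]
  · exact mul_le_mul_of_nonneg_left (h z fun i => (hp i _).lt_of_ne fun h2 =>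
      h0.ne (Finset.prod_eq_zero (Finset.mem_univ i) h2.symm).symm) h0.le

theorem prodExpect_prod_comp {κ : Type*} [Fintype κ] {p : ι → Z → ℝ} (hp : ∀ i, ∑ b, p i b = 1)
    {e : κ → ι} (he : Function.Injective e) (g : κ → Z → ℝ) :
    prodExpect p (fun z => ∏ j, g j (z (e j))) = ∏ j, ∑ b, p (e j) b * g j b := by
  set G : ι → Z → ℝ := Function.extend e g (fun _ _ => 1) with hG
  have h1 : ∀ j, G (e j) = g j := fun j => he.extend_apply _ _ _
  have h2 : ∀ i, i ∉ Set.range e → G i = fun _ => 1 := fun i hi =>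
    Function.extend_apply' _ _ _ (by simpa using hi)
  have h3 : (fun z : ι → Z => ∏ j, g j (z (e j))) = fun z => ∏ i, G i (z i) := by
    ext z
    exact Fintype.prod_of_injective e he _ _ (fun i hi => by rw [h2 i hi]) fun j => by rw [h1]
  rw [h3, prodExpect_prod]
  symm
  refine Fintype.prod_of_injective e he _ _ (fun i hi => ?_) fun j => by rw [h1]
  rw [h2 i hi]
  simpa using hp i

end ProdExpect

/-! ### Random coding with expurgation. -/

section Expurgation

variable {Z : Type*} [Fintype Z]

/-- Random coding with expurgation: codewords of small individual cost and small total pairwise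
cost. -/
theorem exists_codebook_cost_le {w : Z → ℝ} (hw : ∀ z, 0 ≤ w z) (hw1 : ∑ z, w z = 1)
    {f : Z → ℝ} (hf0 : ∀ z, 0 ≤ f z) {g : Z → Z → ℝ} (hg0 : ∀ z z', 0 ≤ g z z') {a b : ℝ}
    (hf : ∑ z, w z * f z ≤ a) (hg : ∀ z, ∑ z', w z' * g z z' ≤ b) (M : ℕ) :
    ∃ c : Fin M → Z, ∀ m, f (c m) + ∑ m' ∈ Finset.univ.erase m, g (c m) (c m') ≤
      2 * (a + 2 * M * b) := by
  classical
  have ha : 0 ≤ a := (Finset.sum_nonneg fun z _ => mul_nonneg (hw z) (hf0 z)).trans hf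
  have hb : 0 ≤ b := by
    have hne : Nonempty Z := by
      by_contra h
      rw [not_nonempty_iff] at h
      simp at hw1
    obtain ⟨z⟩ := hne
    exact (Finset.sum_nonneg fun z' _ => mul_nonneg (hw z') (hg0 z z')).trans (hg z)
  set D : ℝ := a + 2 * M * b with hD
  have hD0 : 0 ≤ D := by positivity
  set cost : (Fin (2 * M) → Z) → Fin (2 * M) → ℝ := fun c m =>
    f (c m) + ∑ m' ∈ Finset.univ.erase m, g (c m) (c m') with hcost
  have hw' : ∀ _ : Fin (2 * M), ∑ z, w z = 1 := fun _ => hw1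
  have hpair : ∀ m m' : Fin (2 * M), m ≠ m' →
      prodExpect (fun _ => w) (fun c : Fin (2 * M) → Z => g (c m) (c m')) ≤ b := by
    intro m m' hne
    rw [prodExpect_resample hw' m']
    simp only [Function.update_self, Function.update_of_ne hne]
    exact (prodExpect_mono (fun _ => hw) fun c => hg (c m)).trans_eq (prodExpect_const hw' b)
  have hmean : prodExpect (fun _ => w) (fun c => ∑ m, cost c m) ≤ 2 * M * D := by
    rw [prodExpect_sum]
    have : ∀ m, prodExpect (fun _ => w) (fun c => cost c m) ≤ D := by
      intro m
      simp only [hcost]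
      rw [prodExpect_add, prodExpect_sum, prodExpect_eval hw' m f]
      refine add_le_add hf ?_
      calc _ ≤ ∑ m' ∈ Finset.univ.erase m, b :=
            Finset.sum_le_sum fun m' hm' => hpair m m' (Finset.ne_of_mem_erase hm').symm
        _ ≤ ∑ _m' : Fin (2 * M), b :=
            Finset.sum_le_sum_of_subset_of_nonneg (Finset.erase_subset _ _) fun _ _ _ => hb
        _ = _ := by simp
    refine (Finset.sum_le_sum fun m _ => this m).trans_eq ?_
    simp
  obtain ⟨c, hc⟩ := exists_le_of_prodExpect_le (fun _ => hw) hw' hmean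
  set G : Finset (Fin (2 * M)) := Finset.univ.filter fun m => cost c m ≤ 2 * D with hG
  have hcost0 : ∀ m, 0 ≤ cost c m := fun m =>
    add_nonneg (hf0 _) (Finset.sum_nonneg fun _ _ => hg0 _ _)
  -- Markov's inequality: of `2M` codewords with average cost at most `D`, at least half cost at
  -- most `2D`. Discarding the rest can only lower pairwise costs.
  have hcard : M ≤ G.card := by
    by_contra! hlt
    have h1 : M + 1 ≤ Gᶜ.card := by
      rw [Finset.card_compl, Fintype.card_fin]
      omega
    have hne : Gᶜ.Nonempty := Finset.card_pos.1 (by omega)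
    have h2 : Gᶜ.card * (2 * D) < ∑ m ∈ Gᶜ, cost c m := by
      rw [← nsmul_eq_mul, ← Finset.sum_const]
      exact Finset.sum_lt_sum_of_nonempty hne fun m hm => by
        simpa [hG] using hm
    have h3 : ∑ m ∈ Gᶜ, cost c m ≤ ∑ m, cost c m :=
      Finset.sum_le_sum_of_subset_of_nonneg (Finset.subset_univ _) fun m _ _ => hcost0 m
    have h4 : ((M : ℝ) + 1) * (2 * D) ≤ Gᶜ.card * (2 * D) :=
      mul_le_mul_of_nonneg_right (by exact_mod_cast h1) (by linarith)
    linarith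
  set e := G.orderEmbOfCardLe hcard with he
  refine ⟨fun m => c (e m), fun m => ?_⟩
  have hmem := (Finset.mem_filter.1 (G.orderEmbOfCardLe_mem hcard m)).2
  refine le_trans ?_ hmem
  refine add_le_add le_rfl ?_
  rw [← Finset.sum_image (s := Finset.univ.erase m) (g := e) (f := fun j => g (c (e m)) (c j))
    fun _ _ _ _ h => e.injective h]
  refine Finset.sum_le_sum_of_subset_of_nonneg (fun j hj => ?_) fun _ _ _ => hg0 _ _
  obtain ⟨i, hi, rfl⟩ := Finset.mem_image.1 hj
  exact Finset.mem_erase.2 ⟨fun h => Finset.ne_of_mem_erase hi (e.injective h),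
    Finset.mem_univ _⟩

end Expurgation

/-! ### The detect-then-decode scheme. -/

section DetectCode

variable {X Y : Type*}

/-- The block of `N` outputs that starts at `u`. -/
def window {A N : ℕ} (u : Fin A) (y : Fin (A + N - 1) → Y) : Fin N → Y :=
  fun j => y ⟨u + j, by omega⟩

/-- The likelihood ratio test for the output law `q` against the noise `p`. -/
def Detects {N : ℕ} (p q : Y → ℝ) (z : Fin N → Y) : Prop :=
  ∏ j, p (z j) ≤ ∏ j, q (z j)

/-- The information density of the codeword `x` and the outputs `z` is at least `γ`. -/
def Passes [Fintype Y] {N : ℕ} (Q : Channel X Y) (q : Y → ℝ) (γ : ℝ) (x : Fin N → X)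
    (z : Fin N → Y) : Prop :=
  Real.exp γ * ∏ j, q (z j) ≤ ∏ j, Q (x j) (z j)

/-- The stopping condition of the decoder that first detects a transmission and then attempts to
decode for the length of a block. -/
def StopCond [Fintype Y] {A N M : ℕ} (Q : Channel X Y) (star : X) (q : Y → ℝ) (γ : ℝ)
    (x : Fin M → Fin N → X) (t : Fin (A + N - 1)) (y : Fin (A + N - 1) → Y) : Prop :=
  (t : ℕ) + 1 = A + N - 1 ∨ ∃ u₀ : Fin A, Detects (Q star) q (window u₀ y) ∧
    (u₀ : ℕ) + N ≤ t + 1 ∧ ((u₀ : ℕ) + 2 * N ≤ t + 1 ∨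
      ∃ (m : Fin M) (u : Fin A), (u : ℕ) + N = t + 1 ∧ Passes Q q γ (x m) (window u y))

theorem window_congr {A N : ℕ} {t : Fin (A + N - 1)} {u : Fin A}
    (hu : (u : ℕ) + N ≤ t + 1) {y y' : Fin (A + N - 1) → Y} (h : ∀ i, i ≤ t → y' i = y i) :
    window u y' = window u y := by
  ext j
  exact h _ (Fin.le_def.2 (by simp only; omega))

theorem stopCond_congr [Fintype Y] {A N M : ℕ} {Q : Channel X Y} {star : X} {q : Y → ℝ} {γ : ℝ}
    {x : Fin M → Fin N → X} {t : Fin (A + N - 1)} {y y' : Fin (A + N - 1) → Y}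
    (h : ∀ i, i ≤ t → y' i = y i) :
    StopCond Q star q γ x t y' ↔ StopCond Q star q γ x t y := by
  unfold StopCond
  refine or_congr_right (exists_congr fun u₀ => ?_)
  by_cases hu : (u₀ : ℕ) + N ≤ t + 1
  · rw [window_congr hu h]
    refine and_congr_right' (and_congr_right' (or_congr_right
      (exists_congr fun m => exists_congr fun u => and_congr_right fun hu => ?_)))
    rw [window_congr hu.le h]
  · simp [hu]

open Classical in
/-- The first time at which the stopping condition holds. -/
def firstStop [Fintype Y] {A N M : ℕ} (hA : 1 ≤ A) (hN : 1 ≤ N) (Q : Channel X Y) (star : X)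
    (q : Y → ℝ) (γ : ℝ) (x : Fin M → Fin N → X) (y : Fin (A + N - 1) → Y) : Fin (A + N - 1) :=
  (Finset.univ.filter fun t : Fin (A + N - 1) => StopCond Q star q γ x t y).min'
    -- The last index, at which stopping is forced.
    ⟨⟨A + N - 2, by omega⟩, Finset.mem_filter.2 ⟨Finset.mem_univ _, Or.inl (by simp only; omega)⟩⟩

section FirstStop

variable [Fintype Y] {A N M : ℕ} {hA : 1 ≤ A} {hN : 1 ≤ N} {Q : Channel X Y} {star : X}
  {q : Y → ℝ} {γ : ℝ} {x : Fin M → Fin N → X} {y : Fin (A + N - 1) → Y}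

theorem stopCond_firstStop :
    StopCond Q star q γ x (firstStop hA hN Q star q γ x y) y := by
  classical
  have h : firstStop hA hN Q star q γ x y ∈
      Finset.univ.filter fun t => StopCond Q star q γ x t y := by
    unfold firstStop
    exact Finset.min'_mem _ _
  exact (Finset.mem_filter.1 h).2

theorem firstStop_le {t : Fin (A + N - 1)} (ht : StopCond Q star q γ x t y) :
    firstStop hA hN Q star q γ x y ≤ t := by
  classical
  unfold firstStop
  exact Finset.min'_le (Finset.univ.filter fun t : Fin (A + N - 1) => StopCond Q star q γ x t y) t
    (Finset.mem_filter.2 ⟨Finset.mem_univ _, ht⟩)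

theorem firstStop_congr {y' : Fin (A + N - 1) → Y}
    (h : ∀ i, i ≤ firstStop hA hN Q star q γ x y → y' i = y i) :
    firstStop hA hN Q star q γ x y' = firstStop hA hN Q star q γ x y := by
  have h1 : firstStop hA hN Q star q γ x y' ≤ firstStop hA hN Q star q γ x y :=
    firstStop_le ((stopCond_congr h).2 stopCond_firstStop)
  refine le_antisymm h1 (firstStop_le ?_)
  exact (stopCond_congr fun i hi => h i (hi.trans h1)).1 stopCond_firstStop

end FirstStop

open Classical in
/-- The code with the codebook `x` whose decoder stops as soon as it has detected a transmission
and one of the codewords passes the test on the latest block of outputs. -/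
def detectCode [Fintype Y] {A N M : ℕ} (hA : 1 ≤ A) (hN : 1 ≤ N) (hM : 2 ≤ M) (Q : Channel X Y)
    (star : X) (q : Y → ℝ) (γ : ℝ) (x : Fin M → Fin N → X) : Code X Y N where
  numMsg := M
  two_le_numMsg := hM
  codeword := x
  level := A
  one_le_level := hA
  numSeed := 1
  seedProb := fun _ => 1
  seedProb_nonneg := fun _ => zero_le_one
  seedProb_sum := by simp
  stopAt := fun _ => firstStop hA hN Q star q γ x
  stopAt_adapted := fun _ _ _ h => firstStop_congr h
  decisionRule := fun t z =>
    if h : ∃ m, ∃ _ : N ≤ (t : ℕ) + 1,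
      Passes Q q γ (x m) (fun j => z ⟨(t : ℕ) + 1 - N + j, by omega⟩) then h.choose
    else ⟨0, by omega⟩

/-- The channel input over time when `x` starts being sent at `s`. -/
def blockInput {A N : ℕ} (star : X) (x : Fin N → X) (s : Fin A) (i : Fin (A + N - 1)) : X :=
  if h : (s : ℕ) ≤ i ∧ (i : ℕ) < s + N then x ⟨i - s, by omega⟩ else star

section Correctness

variable [Fintype Y] {A N M : ℕ} {hA : 1 ≤ A} {hN : 1 ≤ N} {hM : 2 ≤ M} {Q : Channel X Y}
  {star : X} {q : Y → ℝ} {γ : ℝ} {x : Fin M → Fin N → X}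

/-- The message declared by the decoder of `detectCode`. -/
def detectDecode (hA : 1 ≤ A) (hN : 1 ≤ N) (hM : 2 ≤ M) (Q : Channel X Y) (star : X) (q : Y → ℝ)
    (γ : ℝ) (x : Fin M → Fin N → X) (y : Fin (A + N - 1) → Y) : Fin M :=
  (detectCode hA hN hM Q star q γ x).decoded (0 : Fin 1) y

theorem detectCode_errorProb : (detectCode hA hN hM Q star q γ x).errorProb Q star =
    ⨆ m : Fin M, (1 / (A : ℝ)) * ∑ s : Fin A,
      prodExpect (fun i b => Q (blockInput star (x m) s i) b)
        (fun y => if detectDecode hA hN hM Q star q γ x y ≠ m then 1 else 0) := by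
  have h : (detectCode hA hN hM Q star q γ x).errorProb Q star =
      ⨆ m : Fin M, (1 / (A : ℝ)) * ∑ s : Fin A, ∑ _k : Fin 1, (1 : ℝ) *
        prodExpect (fun i b => Q (blockInput star (x m) s i) b)
          (fun y => if detectDecode hA hN hM Q star q γ x y ≠ m then 1 else 0) := rfl
  rw [h]
  simp only [Fin.sum_univ_one, one_mul]

theorem detectCode_delay : (detectCode hA hN hM Q star q γ x).delay Q star =
    ⨆ m : Fin M, (1 / (A : ℝ)) * ∑ s : Fin A,
      prodExpect (fun i b => Q (blockInput star (x m) s i) b)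
        (fun y => (((firstStop hA hN Q star q γ x y : ℕ) - (s : ℕ) : ℕ) : ℝ)) := by
  have h : (detectCode hA hN hM Q star q γ x).delay Q star =
      ⨆ m : Fin M, (1 / (A : ℝ)) * ∑ s : Fin A, ∑ _k : Fin 1, (1 : ℝ) *
        prodExpect (fun i b => Q (blockInput star (x m) s i) b)
          (fun y => (((firstStop hA hN Q star q γ x y : ℕ) - (s : ℕ) : ℕ) : ℝ)) := rfl
  rw [h]
  simp only [Fin.sum_univ_one, one_mul]

theorem firstStop_le_of_detects_of_passes {m : Fin M} {s : Fin A} {y : Fin (A + N - 1) → Y}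
    (hd : Detects (Q star) q (window s y)) (hp : Passes Q q γ (x m) (window s y)) :
    (firstStop hA hN Q star q γ x y : ℕ) + 1 ≤ s + N := by
  have h : StopCond Q star q γ x (⟨s + N - 1, by omega⟩ : Fin (A + N - 1)) y :=
    Or.inr ⟨s, hd, by simp only; omega, Or.inr ⟨m, s, by simp only; omega, hp⟩⟩
  have := Fin.le_def.1 (firstStop_le (hA := hA) (hN := hN) h)
  simp only at this
  omega

/-- The time-out after detection: a failed decoding costs a second block, not a delay of order `A`.
-/
theorem firstStop_le_of_detects {s : Fin A} {y : Fin (A + N - 1) → Y}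
    (hd : Detects (Q star) q (window s y)) :
    (firstStop hA hN Q star q γ x y : ℕ) + 1 ≤ s + 2 * N := by
  by_cases h2 : (s : ℕ) + 2 * N - 1 < A + N - 1
  · have h : StopCond Q star q γ x (⟨s + 2 * N - 1, h2⟩ : Fin (A + N - 1)) y :=
      Or.inr ⟨s, hd, by simp only; omega, Or.inl (by simp only; omega)⟩
    have := Fin.le_def.1 (firstStop_le (hA := hA) (hN := hN) h)
    simp only at this
    omega
  · have := (firstStop hA hN Q star q γ x y).isLt
    omega

/-- Without detection in blocks of pure noise, and with detection and a pass at `s`, the decoder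
stops on a block that overlaps the transmission and starts no later than it. Hence only such blocks
can confuse messages: `N` of them, rather than `A`. -/
theorem detectDecode_eq {m : Fin M} {s : Fin A} {y : Fin (A + N - 1) → Y}
    (h1 : ∀ u : Fin A, (u : ℕ) + N ≤ s → ¬ Detects (Q star) q (window u y))
    (h2 : Detects (Q star) q (window s y)) (h3 : Passes Q q γ (x m) (window s y))
    (h4 : ∀ m' ≠ m, ∀ u : Fin A, (s : ℕ) < u + N → u ≤ s →
      ¬ Passes Q q γ (x m') (window u y)) :
    detectDecode hA hN hM Q star q γ x y = m := by
  classical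
  have hle := firstStop_le_of_detects_of_passes (hA := hA) (hN := hN) h2 h3
  set t := firstStop hA hN Q star q γ x y with ht
  have hst : StopCond Q star q γ x t y := stopCond_firstStop
  obtain ⟨u, hu, hsu, hus, m', hm'⟩ : ∃ u : Fin A, (u : ℕ) + N = t + 1 ∧ (s : ℕ) < u + N ∧
      u ≤ s ∧ ∃ m', Passes Q q γ (x m') (window u y) := by
    -- A forced stop at the horizon can only be the end of the block at `s`, where `m` passes. A
    -- time-out would require a detection before the start.
    rcases hst with hst | ⟨u₀, hd, hu₀, hst⟩
    · refine ⟨s, by omega, by omega, le_rfl, m, h3⟩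
    · have hs : ¬ (u₀ : ℕ) + N ≤ s := fun h => h1 u₀ h hd
      rcases hst with hst | ⟨m', u, hu, hp⟩
      · omega
      · exact ⟨u, hu, by omega, Fin.le_def.2 (by omega), m', hp⟩
  have hwin : ∀ h : N ≤ (t : ℕ) + 1, (fun j : Fin N => y ⟨(t : ℕ) + 1 - N + j, by omega⟩) =
      window u y := by
    intro h
    ext j
    unfold window
    congr 2
    omega
  have hex : ∃ m, ∃ _ : N ≤ (t : ℕ) + 1,
      Passes Q q γ (x m) (fun j => y ⟨(t : ℕ) + 1 - N + j, by omega⟩) :=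
    ⟨m', by omega, by rw [hwin (by omega)]; exact hm'⟩
  have hdec : detectDecode hA hN hM Q star q γ x y = hex.choose := dif_pos hex
  have hall : ∀ m'', (∃ _ : N ≤ (t : ℕ) + 1,
      Passes Q q γ (x m'') (fun j => y ⟨(t : ℕ) + 1 - N + j, by omega⟩)) → m'' = m := by
    rintro m'' ⟨hN', hp⟩
    rw [hwin hN'] at hp
    by_contra hne
    exact h4 _ hne u hsu hus hp
  exact hdec.trans (hall _ hex.choose_spec)

end Correctness
end DetectCode

/-! ### Error events and their probabilities. -/

open Classical in
/-- The indicator of a proposition, as a real number. -/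
def ind (p : Prop) : ℝ := if p then 1 else 0

theorem ind_of_pos {p : Prop} (h : p) : ind p = 1 := by simp [ind, h]

theorem ind_of_neg {p : Prop} (h : ¬ p) : ind p = 0 := by simp [ind, h]

theorem ind_nonneg (p : Prop) : 0 ≤ ind p := by
  by_cases h : p <;> simp [ind, h]

theorem ind_le {p : Prop} {a : ℝ} (h0 : 0 ≤ a) (h1 : p → 1 ≤ a) : ind p ≤ a := by
  by_cases h : p
  · rw [ind_of_pos h]; exact h1 h
  · rwa [ind_of_neg h]

/-- Chernoff's bound with exponent one half, which treats false alarms and misses symmetrically and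
yields the Bhattacharyya coefficient for both. -/
theorem one_le_prod_sqrt_div {Y : Type*} {N : ℕ} {p q : Y → ℝ} (hp : ∀ y, 0 < p y) (hq : ∀ y, 0 < q y)
    {z : Fin N → Y} (h : ∏ j, p (z j) ≤ ∏ j, q (z j)) : 1 ≤ ∏ j, √(q (z j) / p (z j)) := by
  rw [← Real.sqrt_prod _ (fun j _ => (div_pos (hq _) (hp _)).le), Finset.prod_div_distrib,
    Real.one_le_sqrt, one_le_div (Finset.prod_pos fun j _ => hp _)]
  exact h

section WindowBounds

variable {X Y : Type*} [Fintype Y] {A N : ℕ}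

theorem window_injective (u : Fin A) :
    Function.Injective (fun j : Fin N => (⟨u + j, by omega⟩ : Fin (A + N - 1))) := by
  intro i j h
  simp only [Fin.mk.injEq] at h
  exact Fin.ext (by omega)

theorem prodExpect_prod_window {r : Fin (A + N - 1) → Y → ℝ} (hr1 : ∀ i, ∑ b, r i b = 1)
    (u : Fin A) (g : Fin N → Y → ℝ) :
    prodExpect r (fun y => ∏ j, g j (window u y j)) =
      ∏ j : Fin N, ∑ b, r ⟨u + j, by omega⟩ b * g j b :=
  prodExpect_prod_comp hr1 (window_injective u) g

theorem prodExpect_detects_le {r : Fin (A + N - 1) → Y → ℝ} (hr : ∀ i b, 0 ≤ r i b)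
    (hr1 : ∀ i, ∑ b, r i b = 1) {p q : Y → ℝ} (hp : ∀ y, 0 < p y) (hq : ∀ y, 0 < q y)
    (u : Fin A) : prodExpect r (fun y => ind (Detects p q (window u y))) ≤
      ∏ j : Fin N, ∑ b, r ⟨u + j, by omega⟩ b * √(q b / p b) := by
  rw [← prodExpect_prod_window hr1 u fun _ b => √(q b / p b)]
  exact prodExpect_mono hr fun y => ind_le (Finset.prod_nonneg fun _ _ => Real.sqrt_nonneg _)
    fun h => one_le_prod_sqrt_div hp hq h

theorem prodExpect_not_detects_le {r : Fin (A + N - 1) → Y → ℝ} (hr : ∀ i b, 0 ≤ r i b)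
    (hr1 : ∀ i, ∑ b, r i b = 1) {p q : Y → ℝ} (hp : ∀ y, 0 < p y) (hq : ∀ y, 0 < q y)
    (u : Fin A) : prodExpect r (fun y => ind (¬ Detects p q (window u y))) ≤
      ∏ j : Fin N, ∑ b, r ⟨u + j, by omega⟩ b * √(p b / q b) := by
  rw [← prodExpect_prod_window hr1 u fun _ b => √(p b / q b)]
  exact prodExpect_mono hr fun y => ind_le (Finset.prod_nonneg fun _ _ => Real.sqrt_nonneg _)
    fun h => one_le_prod_sqrt_div hq hp (not_le.1 h).le

/-- Chernoff's bound for the information density, a sum of independent terms; the threshold is `g`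
per symbol. -/
theorem prodExpect_not_passes_le {r : Fin (A + N - 1) → Y → ℝ} (hr : ∀ i b, 0 ≤ r i b)
    (hr1 : ∀ i, ∑ b, r i b = 1) {Q : Channel X Y} {q : Y → ℝ} (hq : ∀ y, 0 < q y)
    (u : Fin A) (x : Fin N → X) (hx : ∀ j : Fin N, r ⟨u + j, by omega⟩ = Q (x j)) (g : ℝ)
    {t : ℝ} (ht : 0 < t) :
    prodExpect r (fun y => ind (¬ Passes Q q (g * N) x (window u y))) ≤
      ∏ j, ∑ b, Q (x j) b * Real.exp (-(t * (Real.log (Q (x j) b / q b) - g))) := by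
  have h1 := prodExpect_prod_window (N := N) hr1 u
    fun j b => Real.exp (-(t * (Real.log (Q (x j) b / q b) - g)))
  simp_rw [hx] at h1
  rw [← h1]
  refine prodExpect_mono_of_pos hr fun y hy => ind_le
    (Finset.prod_nonneg fun _ _ => (Real.exp_pos _).le) fun h => ?_
  have hpos : ∀ j, 0 < Q (x j) (window u y j) := fun j => by
    rw [← hx j]
    exact hy _
  rw [← Real.exp_sum]
  refine Real.one_le_exp ?_
  rw [Passes, not_le] at h
  have h2 := Real.log_lt_log (Finset.prod_pos fun j _ => hpos j) h
  rw [Real.log_mul (Real.exp_pos _).ne' (Finset.prod_pos fun j _ => hq _).ne', Real.log_exp,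
    Real.log_prod fun j _ => (hpos j).ne', Real.log_prod fun j _ => (hq _).ne'] at h2
  rw [Finset.sum_neg_distrib, ← Finset.mul_sum, Finset.sum_sub_distrib]
  have h3 : ∑ j, Real.log (Q (x j) (window u y j) / q (window u y j)) =
      ∑ j, Real.log (Q (x j) (window u y j)) - ∑ j, Real.log (q (window u y j)) := by
    rw [← Finset.sum_sub_distrib]
    exact Finset.sum_congr rfl fun j _ => Real.log_div (hpos j).ne' (hq _).ne'
  rw [h3]
  simp only [Finset.sum_const, Finset.card_univ, Fintype.card_fin, nsmul_eq_mul]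
  nlinarith

/-- A codeword drawn at random independently of the outputs passes with small probability. -/
theorem sum_prod_mul_passes_le [Fintype X] {r : Fin (A + N - 1) → Y → ℝ}
    (hr : ∀ i b, 0 ≤ r i b) (hr1 : ∀ i, ∑ b, r i b = 1) {Q : Channel X Y} {P : stdSimplex ℝ X}
    (hq : ∀ y, 0 < outputDist Q P y) (u : Fin A) (γ : ℝ) :
    ∑ x : Fin N → X, (∏ j, P (x j)) *
      prodExpect r (fun y => ind (Passes Q (outputDist Q P) γ x (window u y))) ≤
      Real.exp (-γ) := by
  -- Markov's inequality for each fixed block `z`, as `∑ P(x) Q(z|x)/q(z) = 1`. The law of the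
  -- outputs is irrelevant, so blocks mixing noise with part of another codeword are covered.
  have h1 : ∀ z : Fin N → Y, prodExpect (fun _ x => P x)
      (fun x : Fin N → X => ind (Passes Q (outputDist Q P) γ x z)) ≤ Real.exp (-γ) := by
    intro z
    calc _ ≤ prodExpect (fun _ x => P x) (fun x : Fin N → X =>
          Real.exp (-γ) * ∏ j, Q (x j) (z j) / outputDist Q P (z j)) := by
          refine prodExpect_mono (fun _ x => stdSimplex.zero_le P x) fun x => ind_le ?_ ?_
          · exact mul_nonneg (Real.exp_pos _).le (Finset.prod_nonneg fun j _ =>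
              div_nonneg (stdSimplex.zero_le (Q _) _) (hq _).le)
          · intro h
            rw [Real.exp_neg, Finset.prod_div_distrib, inv_mul_eq_div,
              one_le_div (Real.exp_pos _), le_div_iff₀ (Finset.prod_pos fun j _ => hq _)]
            exact h
      _ = Real.exp (-γ) * ∏ j, ∑ x, P x * (Q x (z j) / outputDist Q P (z j)) := by
          rw [prodExpect_mul_left, prodExpect_prod (fun _ x => P x)
            (fun j x => Q x (z j) / outputDist Q P (z j))]
      _ = Real.exp (-γ) := by
          rw [Finset.prod_eq_one, mul_one]
          intro j _
          simp_rw [← mul_div_assoc]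
          rw [← Finset.sum_div]
          exact div_self (hq (z j)).ne'
  simp_rw [← prodExpect_mul_left]
  rw [← prodExpect_sum]
  exact (prodExpect_mono hr fun y => h1 (window u y)).trans_eq (prodExpect_const hr1 _)

end WindowBounds

theorem blockInput_window {A N : ℕ} {X : Type*} (star : X) (x : Fin N → X) (s : Fin A) (j : Fin N) :
    blockInput star x s (⟨s + j, by omega⟩ : Fin (A + N - 1)) = x j := by
  rw [blockInput, dif_pos ⟨by simp only; omega, by simp only; omega⟩]
  congr 1
  exact Fin.ext (by simp only; omega)

theorem blockInput_of_lt {A N : ℕ} {X : Type*} (star : X) (x : Fin N → X) {s : Fin A}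
    {i : Fin (A + N - 1)} (h : (i : ℕ) < s) : blockInput star x s i = star := by
  rw [blockInput, dif_neg (by omega)]

/-! ### Pointwise bounds on error and delay. -/

section Pointwise

variable {X Y : Type*} [Fintype Y] {A N M : ℕ} {hA : 1 ≤ A} {hN : 1 ≤ N} {hM : 2 ≤ M}
  {Q : Channel X Y} {star : X} {q : Y → ℝ} {γ : ℝ} {x : Fin M → Fin N → X}

theorem ite_detectDecode_ne_le (m : Fin M) (s : Fin A) (y : Fin (A + N - 1) → Y) :
    (if detectDecode hA hN hM Q star q γ x y ≠ m then (1 : ℝ) else 0) ≤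
      ((∑ u ∈ Finset.univ.filter (fun u : Fin A => (u : ℕ) + N ≤ s),
        ind (Detects (Q star) q (window u y))) + ind (¬ Detects (Q star) q (window s y))) +
      (ind (¬ Passes Q q γ (x m) (window s y)) +
      ∑ m' ∈ Finset.univ.erase m,
        ∑ u ∈ Finset.univ.filter (fun u : Fin A => (s : ℕ) < u + N ∧ u ≤ s),
          ind (Passes Q q γ (x m') (window u y))) := by
  classical
  have n1 : 0 ≤ ∑ u ∈ Finset.univ.filter (fun u : Fin A => (u : ℕ) + N ≤ s),
      ind (Detects (Q star) q (window u y)) := Finset.sum_nonneg fun _ _ => ind_nonneg _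
  have n2 := ind_nonneg (¬ Detects (Q star) q (window s y))
  have n3 := ind_nonneg (¬ Passes Q q γ (x m) (window s y))
  have n4' : ∀ m', 0 ≤ ∑ u ∈ Finset.univ.filter (fun u : Fin A => (s : ℕ) < u + N ∧ u ≤ s),
      ind (Passes Q q γ (x m') (window u y)) :=
    fun m' => Finset.sum_nonneg fun _ _ => ind_nonneg _
  have n4 := Finset.sum_nonneg fun m' (_ : m' ∈ Finset.univ.erase m) => n4' m'
  by_cases h1 : ∀ u : Fin A, (u : ℕ) + N ≤ s → ¬ Detects (Q star) q (window u y)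
  swap
  · push Not at h1
    obtain ⟨u, hu, hd⟩ := h1
    have hmem : u ∈ Finset.univ.filter (fun u : Fin A => (u : ℕ) + N ≤ s) :=
      Finset.mem_filter.2 ⟨Finset.mem_univ u, hu⟩
    have := Finset.single_le_sum
      (f := fun u => ind (Detects (Q star) q (window u y))) (fun _ _ => ind_nonneg _) hmem
    simp only [ind_of_pos hd] at this
    split_ifs <;> linarith
  by_cases h2 : Detects (Q star) q (window s y)
  swap
  · rw [ind_of_pos h2] at n2 ⊢
    split_ifs <;> linarith
  by_cases h3 : Passes Q q γ (x m) (window s y)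
  swap
  · rw [ind_of_pos h3] at n3 ⊢
    split_ifs <;> linarith
  by_cases h4 : ∀ m' ≠ m, ∀ u : Fin A, (s : ℕ) < u + N → u ≤ s →
      ¬ Passes Q q γ (x m') (window u y)
  · rw [if_neg (not_not.2 (detectDecode_eq h1 h2 h3 h4))]
    linarith
  · push Not at h4
    obtain ⟨m', hm', u, hu, hus, hpass⟩ := h4
    have hmem : u ∈ Finset.univ.filter (fun u : Fin A => (s : ℕ) < u + N ∧ u ≤ s) :=
      Finset.mem_filter.2 ⟨Finset.mem_univ u, hu, hus⟩
    have e1 := Finset.single_le_sum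
      (f := fun u => ind (Passes Q q γ (x m') (window u y))) (fun _ _ => ind_nonneg _) hmem
    have e2 := Finset.single_le_sum (f := fun m' =>
        ∑ u ∈ Finset.univ.filter (fun u : Fin A => (s : ℕ) < u + N ∧ u ≤ s),
          ind (Passes Q q γ (x m') (window u y))) (fun m' _ => n4' m')
      (Finset.mem_erase.2 ⟨hm', Finset.mem_univ m'⟩)
    simp only [ind_of_pos hpass] at e1
    have e3 := e1.trans e2
    split_ifs <;> linarith

/-- Only a missed detection is charged the whole horizon. Its probability must beat `A`, whereas the
probability of a failed pass, whose exponent may be tiny near capacity, need only vanish. -/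
theorem firstStop_sub_le (m : Fin M) (s : Fin A) (y : Fin (A + N - 1) → Y) :
    (((firstStop hA hN Q star q γ x y : ℕ) - (s : ℕ) : ℕ) : ℝ) ≤
      ((N : ℝ) + N * ind (¬ Passes Q q γ (x m) (window s y))) +
        ((A : ℝ) + N) * ind (¬ Detects (Q star) q (window s y)) := by
  by_cases h2 : Detects (Q star) q (window s y)
  · rw [ind_of_neg (not_not.2 h2)]
    by_cases h3 : Passes Q q γ (x m) (window s y)
    · rw [ind_of_neg (not_not.2 h3)]
      have := firstStop_le_of_detects_of_passes (hA := hA) (hN := hN) h2 h3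
      have h5 : (firstStop hA hN Q star q γ x y : ℕ) - (s : ℕ) ≤ N := by omega
      simpa using h5
    · rw [ind_of_pos h3]
      have := firstStop_le_of_detects (hA := hA) (hN := hN) (Q := Q) (γ := γ) (x := x) h2
      have h5 : (firstStop hA hN Q star q γ x y : ℕ) - (s : ℕ) ≤ N + N := by omega
      have h6 : (((firstStop hA hN Q star q γ x y : ℕ) - (s : ℕ) : ℕ) : ℝ) ≤
        N + N := by exact_mod_cast h5
      linarith
  · rw [ind_of_pos h2]
    have h5 : (firstStop hA hN Q star q γ x y : ℕ) - (s : ℕ) ≤ A + N := by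
      have := (firstStop hA hN Q star q γ x y).isLt
      omega
    have h6 : (((firstStop hA hN Q star q γ x y : ℕ) - (s : ℕ) : ℕ) : ℝ) ≤
        A + N := by exact_mod_cast h5
    have h7 := mul_nonneg (Nat.cast_nonneg (α := ℝ) N)
      (ind_nonneg (¬ Passes Q q γ (x m) (window s y)))
    linarith

end Pointwise

/-! ### Existence of good codes at fixed parameters. -/

section ExistsCode

variable {X Y : Type*} [Fintype X] [Fintype Y]

/-- For every level and number of messages there is a code whose error probability and delay obey
the random coding bounds. -/
theorem exists_code_of_params {Q : Channel X Y} {star : X} {P : stdSimplex ℝ X}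
    (hq : ∀ y, 0 < outputDist Q P y) (hp : ∀ y, 0 < Q star y) {A N M : ℕ} (hA : 1 ≤ A)
    (hN : 1 ≤ N) (hM : 2 ≤ M) (g : ℝ) {t : ℝ} (ht : 0 < t) {ρ κ D : ℝ}
    (hρ : ρ = ∑ y, √(Q star y) * √(outputDist Q P y))
    (hκ : κ = ∑ x, P x * ∑ b, Q x b *
      Real.exp (-(t * (Real.log (Q x b / outputDist Q P b) - g))))
    (hD : D = (A + N) * ρ ^ N + κ ^ N + 2 * M * (N * Real.exp (-(g * N)))) :
    ∃ c : Code X Y N, c.level = A ∧ c.numMsg = M ∧ c.errorProb Q star ≤ A * ρ ^ N + 2 * D ∧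
      c.delay Q star ≤ N * (1 + 2 * D) := by
  classical
  set q : Y → ℝ := outputDist Q P with hqdef
  have hA0 : (0 : ℝ) < A := by exact_mod_cast hA
  have hN0 : (0 : ℝ) < N := by exact_mod_cast hN
  have hAinv : (0 : ℝ) ≤ 1 / A := by positivity
  have hρ0 : 0 ≤ ρ := by rw [hρ]; positivity
  set miss : (Fin N → X) → ℝ := fun x => ∏ j, ∑ b, Q (x j) b * √(Q star b / q b) with hmiss
  set fail : (Fin N → X) → ℝ := fun x => ∏ j, ∑ b, Q (x j) b *
      Real.exp (-(t * (Real.log (Q (x j) b / q b) - g))) with hfail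
  have hmiss0 : ∀ x, 0 ≤ miss x := fun x => Finset.prod_nonneg fun j _ =>
    Finset.sum_nonneg fun b _ => mul_nonneg (stdSimplex.zero_le (Q _) b) (Real.sqrt_nonneg _)
  have hfail0 : ∀ x, 0 ≤ fail x := fun x => Finset.prod_nonneg fun j _ =>
    Finset.sum_nonneg fun b _ => mul_nonneg (stdSimplex.zero_le (Q _) b) (Real.exp_pos _).le
  set law : (Fin N → X) → Fin A → Fin (A + N - 1) → Y → ℝ := fun x s i b =>
    Q (blockInput star x s i) b with hlaw
  have hlaw0 : ∀ x s i b, 0 ≤ law x s i b := fun x s i b => stdSimplex.zero_le (Q _) b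
  have hlaw1 : ∀ x s i, ∑ b, law x s i b = 1 := fun x s i => stdSimplex.sum_eq_one (Q _)
  set starts : Fin A → Finset (Fin A) := fun s =>
    Finset.univ.filter fun u => (s : ℕ) < u + N ∧ u ≤ s with hstarts
  set confuse : (Fin N → X) → (Fin N → X) → ℝ := fun x x' => (1 / (A : ℝ)) * ∑ s, ∑ u ∈ starts s,
    prodExpect (law x s) (fun y => ind (Passes Q q (g * N) x' (window u y))) with hconf
  have hconf0 : ∀ x x', 0 ≤ confuse x x' := fun x x' => mul_nonneg hAinv
    (Finset.sum_nonneg fun s _ => Finset.sum_nonneg fun u _ =>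
      prodExpect_nonneg (hlaw0 x s) fun y => ind_nonneg _)
  set wt : (Fin N → X) → ℝ := fun x => ∏ j, P (x j) with hwt
  have hwt0 : ∀ x, 0 ≤ wt x := fun x => Finset.prod_nonneg fun j _ => stdSimplex.zero_le P _
  have hwt1 : ∑ x, wt x = 1 := by
    simpa [prodExpect] using
      prodExpect_one (p := fun (_ : Fin N) x => P x) fun _ => stdSimplex.sum_eq_one P
  have havg : ∀ h : X → ℝ, ∑ x, wt x * ∏ j, h (x j) = (∑ x, P x * h x) ^ N := by
    intro h
    have := prodExpect_prod (fun (_ : Fin N) x => P x) fun _ x => h x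
    simpa [prodExpect] using this
  -- A single codeword need not have miss bound `ρ^N`; averaging over the codebook turns the output
  -- law into `q`, and `∑ q √(Q_⋆/q) = ρ`.
  have hmissavg : ∑ x, wt x * miss x = ρ ^ N := by
    rw [hmiss, havg fun x => ∑ b, Q x b * √(Q star b / q b), hρ]
    congr 1
    simp_rw [Finset.mul_sum]
    rw [Finset.sum_comm]
    refine Finset.sum_congr rfl fun b _ => ?_
    have h1 : ∑ x, P x * (Q x b * √(Q star b / q b)) = q b * √(Q star b / q b) := by
      rw [hqdef]
      simp only [outputDist]
      rw [Finset.sum_mul]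
      exact Finset.sum_congr rfl fun x _ => by ring
    rw [h1, Real.sqrt_div (hp b).le]
    have h2 := Real.mul_self_sqrt (hq b).le
    have h3 := Real.sqrt_pos.2 (hq b)
    rw [mul_div_assoc', div_eq_iff h3.ne']
    linear_combination -√(Q star b) * h2
  have hfailavg : ∑ x, wt x * fail x = κ ^ N := by
    rw [hfail, havg fun x => ∑ b, Q x b *
      Real.exp (-(t * (Real.log (Q x b / q b) - g))), hκ]
  have hcostavg : ∑ x, wt x * (((A : ℝ) + N) * miss x + fail x) ≤ (A + N) * ρ ^ N + κ ^ N := by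
    rw [← hmissavg, ← hfailavg, Finset.mul_sum, ← Finset.sum_add_distrib]
    exact Finset.sum_le_sum fun x _ => by linarith
  have hstartscard : ∀ s, ((starts s).card : ℝ) ≤ N := fun s => by
    exact_mod_cast card_fin_filter_le (s + 1 - N) (s + 1) N _
      (fun u hu => ⟨by omega, by have := Fin.le_def.1 hu.2; omega⟩) (by omega)
  have hconfavg : ∀ x, ∑ x', wt x' * confuse x x' ≤ N * Real.exp (-(g * N)) := by
    intro x
    have h1 : ∑ x', wt x' * confuse x x' = (1 / (A : ℝ)) * ∑ s, ∑ u ∈ starts s, ∑ x', wt x' *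
        prodExpect (law x s) (fun y => ind (Passes Q q (g * N) x' (window u y))) := by
      simp only [hconf, Finset.mul_sum]
      rw [Finset.sum_comm]
      refine Finset.sum_congr rfl fun s _ => ?_
      rw [Finset.sum_comm]
      exact Finset.sum_congr rfl fun u _ => Finset.sum_congr rfl fun x' _ => by ring
    rw [h1, one_div, inv_mul_le_iff₀ hA0]
    calc _ ≤ ∑ s : Fin A, (N * Real.exp (-(g * N)) : ℝ) := by
          refine Finset.sum_le_sum fun s _ => ?_
          calc _ ≤ ∑ u ∈ starts s, Real.exp (-(g * N)) :=
                Finset.sum_le_sum fun u _ =>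
                  sum_prod_mul_passes_le (hlaw0 x s) (hlaw1 x s) hq u _
            _ = (starts s).card * Real.exp (-(g * N)) := by
                rw [Finset.sum_const, nsmul_eq_mul]
            _ ≤ _ := mul_le_mul_of_nonneg_right (hstartscard s) (Real.exp_pos _).le
      _ = _ := by simp
  obtain ⟨x, hx⟩ := exists_codebook_cost_le hwt0 hwt1
    (f := fun x => ((A : ℝ) + N) * miss x + fail x)
    (fun x => add_nonneg (mul_nonneg (by positivity) (hmiss0 x)) (hfail0 x)) hconf0 hcostavg
    hconfavg M
  rw [← hD] at hx
  have hPmiss : ∀ m s, prodExpect (law (x m) s)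
      (fun y => ind (¬ Detects (Q star) q (window s y))) ≤ miss (x m) := by
    intro m s
    refine (prodExpect_not_detects_le (hlaw0 _ s) (hlaw1 _ s) hp hq s).trans_eq ?_
    simp only [hlaw, hmiss, blockInput_window]
  have hPfail : ∀ m s, prodExpect (law (x m) s)
      (fun y => ind (¬ Passes Q q (g * N) (x m) (window s y))) ≤ fail (x m) := by
    intro m s
    exact prodExpect_not_passes_le (hlaw0 _ s) (hlaw1 _ s) hq s (x m)
      (fun j => by ext b; simp only [hlaw, blockInput_window]) g ht
  have hPfalse : ∀ m (s u : Fin A), (u : ℕ) + N ≤ s → prodExpect (law (x m) s)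
      (fun y => ind (Detects (Q star) q (window u y))) ≤ ρ ^ N := by
    intro m s u hu
    refine (prodExpect_detects_le (hlaw0 _ s) (hlaw1 _ s) hp hq u).trans_eq ?_
    have h1 : ∀ j : Fin N, ∑ b, law (x m) s ⟨u + j, by omega⟩ b * √(q b / Q star b) = ρ := by
      intro j
      simp only [hlaw]
      rw [blockInput_of_lt star (x m) (by simp only; omega), hρ]
      refine Finset.sum_congr rfl fun b _ => ?_
      rw [Real.sqrt_div (hq b).le]
      have h2 := Real.mul_self_sqrt (hp b).le
      have h3 := Real.sqrt_pos.2 (hp b)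
      rw [mul_div_assoc', div_eq_iff h3.ne']
      linear_combination -√(q b) * h2
    simp_rw [h1]
    simp
  have hM0 : Nonempty (Fin M) := ⟨⟨0, by omega⟩⟩
  refine ⟨detectCode hA hN hM Q star q (g * N) x, rfl, rfl, ?_, ?_⟩
  · rw [detectCode_errorProb]
    refine ciSup_le fun m => ?_
    have hs : ∀ s : Fin A, prodExpect (law (x m) s)
        (fun y => if detectDecode hA hN hM Q star q (g * N) x y ≠ m then 1 else 0) ≤
        (A * ρ ^ N + (miss (x m) + fail (x m))) + ∑ m' ∈ Finset.univ.erase m, ∑ u ∈ starts s,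
          prodExpect (law (x m) s) (fun y => ind (Passes Q q (g * N) (x m') (window u y))) := by
      intro s
      refine (prodExpect_mono (hlaw0 (x m) s) (ite_detectDecode_ne_le m s)).trans ?_
      rw [prodExpect_add, prodExpect_add, prodExpect_add, prodExpect_sum, prodExpect_sum]
      simp_rw [prodExpect_sum]
      have e1 : ∑ u ∈ Finset.univ.filter (fun u : Fin A => (u : ℕ) + N ≤ s),
          prodExpect (law (x m) s) (fun y => ind (Detects (Q star) q (window u y))) ≤
          A * ρ ^ N := by
        calc _ ≤ ∑ u ∈ Finset.univ.filter (fun u : Fin A => (u : ℕ) + N ≤ s), ρ ^ N :=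
              Finset.sum_le_sum fun u hu => hPfalse m s u (Finset.mem_filter.1 hu).2
          _ ≤ ∑ u : Fin A, ρ ^ N := Finset.sum_le_sum_of_subset_of_nonneg
              (Finset.filter_subset _ _) fun _ _ _ => pow_nonneg hρ0 N
          _ = _ := by simp
      have e2 := hPmiss m s
      have e3 := hPfail m s
      linarith
    refine (mul_le_mul_of_nonneg_left (Finset.sum_le_sum fun s _ => hs s) hAinv).trans ?_
    rw [Finset.sum_add_distrib, mul_add]
    have e4 : (1 / (A : ℝ)) * ∑ s, ∑ m' ∈ Finset.univ.erase m, ∑ u ∈ starts s,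
        prodExpect (law (x m) s) (fun y => ind (Passes Q q (g * N) (x m') (window u y))) =
        ∑ m' ∈ Finset.univ.erase m, confuse (x m) (x m') := by
      rw [Finset.sum_comm, Finset.mul_sum]
    have e5 : (1 / (A : ℝ)) * ∑ _s : Fin A, (A * ρ ^ N + (miss (x m) + fail (x m))) =
        A * ρ ^ N + (miss (x m) + fail (x m)) := by
      simp only [Finset.sum_const, Finset.card_univ, Fintype.card_fin, nsmul_eq_mul]
      field_simp
    have hxm := hx m
    have hA1 : (1 : ℝ) ≤ A := by exact_mod_cast hA
    have e6 := hmiss0 (x m)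
    have e7 : miss (x m) ≤ (A + N) * miss (x m) := by nlinarith
    exact (add_le_add e5.le e4.le).trans (by linarith)
  · rw [detectCode_delay]
    refine ciSup_le fun m => ?_
    have hs : ∀ s : Fin A, prodExpect (law (x m) s)
        (fun y => (((firstStop hA hN Q star q (g * N) x y : ℕ) - (s : ℕ) : ℕ) : ℝ)) ≤
        N + N * fail (x m) + (A + N) * miss (x m) := by
      intro s
      refine (prodExpect_mono (hlaw0 (x m) s) (firstStop_sub_le m s)).trans ?_
      rw [prodExpect_add, prodExpect_add, prodExpect_const (hlaw1 (x m) s), prodExpect_mul_left,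
        prodExpect_mul_left]
      have e2 := mul_le_mul_of_nonneg_left (hPmiss m s) (by positivity : (0 : ℝ) ≤ A + N)
      have e3 := mul_le_mul_of_nonneg_left (hPfail m s) hN0.le
      linarith
    refine (mul_le_mul_of_nonneg_left (Finset.sum_le_sum fun s _ => hs s) hAinv).trans ?_
    have e5 : (1 / (A : ℝ)) * ∑ _s : Fin A, (N + N * fail (x m) + (A + N) * miss (x m)) =
        N + N * fail (x m) + (A + N) * miss (x m) := by
      simp only [Finset.sum_const, Finset.card_univ, Fintype.card_fin, nsmul_eq_mul]
      field_simp
    have hxm := hx m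
    have hN1 : (1 : ℝ) ≤ N := by exact_mod_cast hN
    have e6 : 0 ≤ ∑ m' ∈ Finset.univ.erase m, confuse (x m) (x m') :=
      Finset.sum_nonneg fun m' _ => hconf0 _ _
    have e7 : 0 ≤ (A + N) * miss (x m) := mul_nonneg (by positivity) (hmiss0 _)
    have e8 : (A + N) * miss (x m) ≤ N * ((A + N) * miss (x m)) := by nlinarith
    have e9 : N * ((A + N) * miss (x m) + fail (x m)) ≤ N * (2 * D) :=
      mul_le_mul_of_nonneg_left (by linarith) hN0.le
    exact e5.le.trans (by linarith)

end ExistsCode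

/-! ### Achievability: from codes of each accuracy to a coding scheme. -/

theorem exists_seq_of_forall_eventually {β : ℕ → Type*} [∀ n, Nonempty (β n)]
    {p : ℝ → (n : ℕ) → β n → Prop} (hmono : ∀ {ε ε' n b}, ε ≤ ε' → p ε n b → p ε' n b)
    (h : ∀ ε : ℝ, 0 < ε → ∀ᶠ n in atTop, ∃ b, p ε n b) :
    ∃ S : (n : ℕ) → β n, ∀ ε : ℝ, 0 < ε → ∀ᶠ n in atTop, p ε n (S n) := by
  classical
  -- Diagonal choice: at each `n` aim for the best accuracy `1/(j + 1)` with `j ≤ n` that is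
  -- attainable there.
  set j : ℕ → ℕ := fun n => Nat.findGreatest (fun j => ∃ b, p (1 / ((j : ℝ) + 1)) n b) n with hj
  refine ⟨fun n => if hb : ∃ b, p (1 / ((j n : ℝ) + 1)) n b then hb.choose
    else Classical.arbitrary _, fun ε hε => ?_⟩
  obtain ⟨J, hJ⟩ := exists_nat_one_div_lt hε
  filter_upwards [h _ (Nat.one_div_pos_of_nat (α := ℝ) (n := J)), eventually_ge_atTop J]
    with n hn hnJ
  have hspec : ∃ b, p (1 / ((j n : ℝ) + 1)) n b :=
    Nat.findGreatest_spec (P := fun j => ∃ b, p (1 / ((j : ℝ) + 1)) n b) hnJ hn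
  have hle : J ≤ j n := Nat.le_findGreatest hnJ hn
  rw [dif_pos hspec]
  refine hmono (le_trans ?_ hJ.le) hspec.choose_spec
  exact Nat.one_div_le_one_div hle

theorem nonempty_code {X Y : Type*} [Nonempty X] (n : ℕ) : Nonempty (Code X Y n) :=
  ⟨{ numMsg := 2
     two_le_numMsg := le_rfl
     codeword := fun _ _ => Classical.arbitrary X
     level := 2
     one_le_level := by norm_num
     numSeed := 1
     seedProb := fun _ => 1
     seedProb_nonneg := fun _ => zero_le_one
     seedProb_sum := by simp
     stopAt := fun _ _ => ⟨0, by omega⟩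
     stopAt_adapted := fun _ _ _ _ => rfl
     decisionRule := fun _ _ => 0 }⟩

section Achievability

variable {X Y : Type*} [Fintype Y]

theorem Code.le_rate {n : ℕ} {c : Code X Y n} {Q : Channel X Y} {star : X} {r : ℝ} (hr : 0 ≤ r)
    (h : r * c.delay Q star ≤ Real.log c.numMsg) : ENNReal.ofReal r ≤ c.rate Q star := by
  have hM : (1 : ℝ) < c.numMsg := by
    have := c.two_le_numMsg
    exact_mod_cast (by omega : 1 < c.numMsg)
  have h0 : ENNReal.ofReal (Real.log c.numMsg) ≠ 0 := by
    simpa using Real.log_pos hM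
  rw [Code.rate, ENNReal.le_div_iff_mul_le (Or.inr h0) (Or.inl ENNReal.ofReal_ne_top),
    ← ENNReal.ofReal_mul hr]
  exact ENNReal.ofReal_le_ofReal h

/-- The parameters are `A ≈ e^{δn}`, `M ≈ e^{(C - 2ν)n}` and threshold `(C - ν)n`. The gap `ν` below
the mean information density makes true codewords pass, and the gap above the rate makes wrong ones
fail. -/
theorem eventually_exists_code [Fintype X] {Q : Channel X Y} {star : X} {P : stdSimplex ℝ X}
    (hP : mutualInfo Q P = capacity Q) (hC : 0 < capacity Q) (hq : ∀ y, 0 < outputDist Q P y)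
    (hp : ∀ y, 0 < Q star y) {δ : ℝ} (hδ : 0 < δ)
    (hδρ : Real.exp δ * ∑ y, √(Q star y) * √(outputDist Q P y) < 1) {ε : ℝ} (hε : 0 < ε) :
    ∀ᶠ n : ℕ in atTop, ∃ c : Code X Y n,
      (Real.exp ((δ - ε) * n) ≤ c.level ∧ (c.level : ℝ) ≤ Real.exp ((δ + ε) * n)) ∧
      ENNReal.ofReal (capacity Q - ε) ≤ c.rate Q star ∧ c.errorProb Q star ≤ ε := by
  set C := capacity Q with hCdef
  set ρ : ℝ := ∑ y, √(Q star y) * √(outputDist Q P y) with hρ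
  have hρ0 : 0 ≤ ρ := by positivity
  have hρ1 : ρ < 1 := by
    have := Real.one_lt_exp_iff.2 hδ
    nlinarith
  set ν : ℝ := min (ε / 4) (C / 4) with hν
  have hν0 : 0 < ν := lt_min (by linarith) (by linarith)
  have hνε : ν ≤ ε / 4 := min_le_left _ _
  have hνC : ν ≤ C / 4 := min_le_right _ _
  obtain ⟨t, ht, hκ1⟩ := exists_sum_mul_exp_lt_one (Z := X × Y) (fun z => P z.1 * Q z.1 z.2)
    (fun z => Real.log (Q z.1 z.2 / outputDist Q P z.2) - (C - ν))
    (by simp [Fintype.sum_prod_type, ← Finset.mul_sum])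
    (by
      have h1 : ∑ z : X × Y, P z.1 * Q z.1 z.2 *
          (Real.log (Q z.1 z.2 / outputDist Q P z.2) - (C - ν)) = mutualInfo Q P - (C - ν) := by
        simp only [mul_sub, Finset.sum_sub_distrib, Fintype.sum_prod_type, mutualInfo, mul_assoc,
          ← Finset.mul_sum]
        simp [← Finset.sum_mul]
      rw [h1, hP]
      linarith)
  set κ : ℝ := ∑ x, P x * ∑ b, Q x b *
      Real.exp (-(t * (Real.log (Q x b / outputDist Q P b) - (C - ν)))) with hκ
  have hκ1' : κ < 1 := by
    rw [hκ]
    simpa only [Fintype.sum_prod_type, Finset.mul_sum, mul_assoc] using hκ1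
  have hκ0 : 0 ≤ κ := Finset.sum_nonneg fun x _ => mul_nonneg (stdSimplex.zero_le P x)
    (Finset.sum_nonneg fun b _ => mul_nonneg (stdSimplex.zero_le (Q x) b) (Real.exp_pos _).le)
  have hlim : Tendsto (fun n : ℕ => 2 * (Real.exp δ * ρ) ^ n + (n : ℝ) ^ 1 * ρ ^ n + κ ^ n +
      4 * ((n : ℝ) ^ 1 * Real.exp (-ν) ^ n)) atTop (nhds (2 * 0 + 0 + 0 + 4 * 0)) := by
    have hν1 : |Real.exp (-ν)| < 1 := by
      rw [abs_of_pos (Real.exp_pos _), Real.exp_lt_one_iff]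
      linarith
    exact ((((tendsto_pow_atTop_nhds_zero_of_lt_one (by positivity) hδρ).const_mul 2).add
      (tendsto_pow_const_mul_const_pow_of_abs_lt_one 1 (by rwa [abs_of_nonneg hρ0]))).add
      (tendsto_pow_atTop_nhds_zero_of_lt_one hκ0 hκ1')).add
      ((tendsto_pow_const_mul_const_pow_of_abs_lt_one 1 hν1).const_mul 4)
  -- `D ≤ ε/3` serves the error bound `A ρ^n + 2D ≤ 3D`; `D ≤ ε/(8C)` keeps the rate loss from the
  -- delay factor `1 + 2D` below `ε/4`.
  have hsmall := hlim.eventually_lt_const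
    (u := min (ε / 3) (ε / (8 * C))) (by
      simp only [mul_zero, add_zero]
      exact lt_min (by positivity) (by positivity))
  have hbig : ∀ᶠ n : ℕ in atTop, 1 ≤ ε * n :=
    ((tendsto_natCast_atTop_atTop (R := ℝ)).const_mul_atTop hε).eventually_ge_atTop _
  filter_upwards [hsmall, hbig, eventually_ge_atTop 1] with n hsmall hbig hn
  have hn0 : (0 : ℝ) < n := by exact_mod_cast hn
  set A : ℕ := ⌈Real.exp (δ * n)⌉₊ with hA
  set M : ℕ := ⌈Real.exp ((C - 2 * ν) * n)⌉₊ with hM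
  have hAge : Real.exp (δ * n) ≤ A := Nat.le_ceil _
  have hMge : Real.exp ((C - 2 * ν) * n) ≤ M := Nat.le_ceil _
  have hAle : (A : ℝ) ≤ 2 * Real.exp (δ * n) := by
    have h1 := (Nat.ceil_lt_add_one (Real.exp_pos (δ * n)).le).le
    have h2 := Real.one_le_exp (by positivity : 0 ≤ δ * n)
    linarith
  have hgap : 0 < (C - 2 * ν) * n := mul_pos (by linarith) hn0
  have hMle : (M : ℝ) ≤ 2 * Real.exp ((C - 2 * ν) * n) := by
    have h1 := (Nat.ceil_lt_add_one (Real.exp_pos ((C - 2 * ν) * n)).le).le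
    have h2 := Real.one_le_exp hgap.le
    linarith
  have hA1 : 1 ≤ A := Nat.ceil_pos.2 (Real.exp_pos _)
  have hM2 : 2 ≤ M := Nat.lt_ceil.2 (by
    rw [Nat.cast_one]
    exact Real.one_lt_exp_iff.2 hgap)
  set D : ℝ := (A + n) * ρ ^ n + κ ^ n + 2 * M * (n * Real.exp (-((C - ν) * n))) with hD
  obtain ⟨c, hcA, hcM, herr, hdel⟩ := exists_code_of_params hq hp hA1 hn hM2 (C - ν) ht hρ hκ hD
  have hρn : 0 ≤ ρ ^ n := pow_nonneg hρ0 n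
  have hκn : 0 ≤ κ ^ n := pow_nonneg hκ0 n
  have hD0 : 0 ≤ D := by positivity
  have hDA : A * ρ ^ n ≤ D := by
    have h1 : 0 ≤ (n : ℝ) * ρ ^ n := by positivity
    have h2 : 0 ≤ 2 * M * (n * Real.exp (-((C - ν) * n))) := by positivity
    rw [hD]
    linarith
  have hDle : D ≤ 2 * (Real.exp δ * ρ) ^ n + (n : ℝ) ^ 1 * ρ ^ n + κ ^ n +
      4 * ((n : ℝ) ^ 1 * Real.exp (-ν) ^ n) := by
    have h1 : A * ρ ^ n ≤ 2 * (Real.exp δ * ρ) ^ n := by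
      rw [mul_pow, ← Real.exp_nat_mul, ← mul_assoc, mul_comm (n : ℝ) δ]
      exact mul_le_mul_of_nonneg_right hAle hρn
    have h2 : 2 * M * (n * Real.exp (-((C - ν) * n))) ≤ 4 * ((n : ℝ) ^ 1 * Real.exp (-ν) ^ n) := by
      calc _ ≤ 2 * (2 * Real.exp ((C - 2 * ν) * n)) * (n * Real.exp (-((C - ν) * n))) := by
            gcongr
        _ = 4 * (n * (Real.exp ((C - 2 * ν) * n) * Real.exp (-((C - ν) * n)))) := by ring
        _ = _ := by
            rw [← Real.exp_add, ← Real.exp_nat_mul, pow_one]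
            ring_nf
    rw [hD, pow_one] at *
    linarith
  have hDε := hDle.trans hsmall.le
  have hD3 : D ≤ ε / 3 := hDε.trans (min_le_left _ _)
  have hD8 : D ≤ ε / (8 * C) := hDε.trans (min_le_right _ _)
  refine ⟨c, ⟨?_, ?_⟩, ?_, ?_⟩
  · rw [hcA]
    refine le_trans (Real.exp_le_exp.2 ?_) hAge
    exact mul_le_mul_of_nonneg_right (by linarith) hn0.le
  · rw [hcA, add_mul, Real.exp_add]
    have h1 : 2 ≤ Real.exp (ε * n) := by linarith [Real.add_one_le_exp (ε * n)]
    have h2 := mul_le_mul_of_nonneg_left h1 (Real.exp_pos (δ * n)).le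
    linarith
  · rcases le_or_gt (C - ε) 0 with hneg | hpos
    · rw [ENNReal.ofReal_of_nonpos hneg]
      exact zero_le
    · refine Code.le_rate hpos.le ?_
      rw [hcM]
      have h1 : (C - 2 * ν) * n ≤ Real.log M := by
        rw [Real.le_log_iff_exp_le (by exact_mod_cast (by omega : 0 < M))]
        exact hMge
      have h2 : D * (8 * C) ≤ ε := (le_div_iff₀ (by positivity)).1 hD8
      have h3 : (C - ε) * (1 + 2 * D) ≤ C - 2 * ν := by
        have : 0 ≤ ε * D := by positivity
        linarith
      calc (C - ε) * c.delay Q star ≤ (C - ε) * (n * (1 + 2 * D)) :=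
            mul_le_mul_of_nonneg_left hdel hpos.le
        _ = (C - ε) * (1 + 2 * D) * n := by ring
        _ ≤ (C - 2 * ν) * n := mul_le_mul_of_nonneg_right h3 hn0.le
        _ ≤ _ := h1
  · linarith

theorem Achieves.mono_rate {Q : Channel X Y} {star : X} {S : (n : ℕ) → Code X Y n} {R R' α : ℝ}
    (h : Achieves Q star S R α) (hR : R' ≤ R) : Achieves Q star S R' α := by
  intro ε hε
  filter_upwards [h ε hε] with n hn
  exact ⟨hn.1, (ENNReal.ofReal_le_ofReal (by linarith)).trans hn.2.1, hn.2.2⟩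

/-- If the noise is not a capacity-achieving output distribution, then the capacity of the
synchronous channel is achievable at a positive asynchronism exponent. -/
theorem exists_pos_le_asyncCapacity [Fintype X] {Q : Channel X Y} {star : X}
    {P : stdSimplex ℝ X} (hP : mutualInfo Q P = capacity Q) (hC : 0 < capacity Q)
    (hq : ∀ y, 0 < outputDist Q P y) (hp : ∀ y, 0 < Q star y)
    (hne : (Q star : Y → ℝ) ≠ outputDist Q P) :
    ∃ δ : ℝ, 0 < δ ∧ ∀ R ≤ capacity Q, ENNReal.ofReal δ ≤ asyncCapacity Q star R := by
  have hρ1 := sum_sqrt_mul_lt_one (fun y => (hp y).le) (fun y => (hq y).le)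
    (stdSimplex.sum_eq_one (Q star)) (sum_outputDist Q P) hne
  set ρ : ℝ := ∑ y, √(Q star y) * √(outputDist Q P y) with hρ
  have hρ0 : 0 ≤ ρ := by positivity
  -- Any `δ > 0` with `e^δ ρ < 1` would do; for this choice the product is `2ρ/(1 + ρ)`.
  have hδρ : Real.exp (Real.log (2 / (1 + ρ))) * ρ < 1 := by
    rw [Real.exp_log (by positivity), div_mul_eq_mul_div, div_lt_one (by positivity)]
    linarith
  have hδ : 0 < Real.log (2 / (1 + ρ)) :=
    Real.log_pos ((one_lt_div (by positivity)).2 (by linarith))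
  set δ : ℝ := Real.log (2 / (1 + ρ))
  have hX : Nonempty X := ⟨star⟩
  have hcode : ∀ n, Nonempty (Code X Y n) := nonempty_code
  obtain ⟨S, hS⟩ := exists_seq_of_forall_eventually (β := fun n => Code X Y n)
    (p := fun ε n c =>
      (Real.exp ((δ - ε) * n) ≤ c.level ∧ (c.level : ℝ) ≤ Real.exp ((δ + ε) * n)) ∧
      ENNReal.ofReal (capacity Q - ε) ≤ c.rate Q star ∧ c.errorProb Q star ≤ ε)
    (fun {ε ε' n c} hle h => by
      have hn : (0 : ℝ) ≤ n := Nat.cast_nonneg n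
      refine ⟨⟨le_trans (Real.exp_le_exp.2 ?_) h.1.1, h.1.2.trans (Real.exp_le_exp.2 ?_)⟩,
        (ENNReal.ofReal_le_ofReal (by linarith)).trans h.2.1, h.2.2.trans hle⟩
      · exact mul_le_mul_of_nonneg_right (by linarith) hn
      · exact mul_le_mul_of_nonneg_right (by linarith) hn)
    (fun ε hε => eventually_exists_code hP hC hq hp hδ hδρ hε)
  have hach : Achieves Q star S (capacity Q) δ := hS
  refine ⟨δ, hδ, fun R hR => le_sSup ⟨⟨δ, hδ.le⟩, ?_, S, hach.mono_rate hR⟩⟩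
  exact ENNReal.ofReal_eq_coe_nnreal hδ.le

end Achievability

end AsyncComm

end

/-! ### The threshold. -/

theorem corollary4 {X Y : Type*} [Fintype X] [Fintype Y]
    (Q : AsyncComm.Channel X Y) (star : X)
    (hreach : ∀ y, ∃ x, 0 < Q x y)
    (hout : ¬ AsyncComm.IsCapacityAchievingOutput Q (Q star))
    (hsync : AsyncComm.syncThreshold Q star < ⊤) :
    ∃ Rstar : ℝ, 0 ≤ Rstar ∧ Rstar < AsyncComm.capacity Q ∧
      ∀ R : ℝ, Rstar < R → R ≤ AsyncComm.capacity Q →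
        AsyncComm.trainingCapacity Q star R < AsyncComm.asyncCapacity Q star R := by
  have hX : Nonempty X := ⟨star⟩
  have hC := AsyncComm.capacity_pos_of_not_isCapacityAchievingOutput hout
  have hp := AsyncComm.noise_pos_of_syncThreshold_lt_top hreach hsync
  obtain ⟨P, hP⟩ := AsyncComm.exists_mutualInfo_eq_capacity Q
  have hq := AsyncComm.outputDist_pos_of_capacity hreach hP
  obtain ⟨δ, hδ, hasync⟩ := AsyncComm.exists_pos_le_asyncCapacity hP hC hq hp
    fun h => hout ⟨P, hP, fun y => (congrFun h y).symm⟩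
  obtain ⟨K, hK1, hK⟩ := AsyncComm.exists_one_le_le_mul_noise hp
  have hL : 0 < Real.log K := Real.log_pos hK1
  set C := AsyncComm.capacity Q
  have hfrac : Real.log K / (Real.log K + δ) < 1 := (div_lt_one (by positivity)).2 (by linarith)
  -- The solution `R` of `ln K · (C - R)/R = δ`; above it the training bound lies below `δ`.
  refine ⟨C * (Real.log K / (Real.log K + δ)), by positivity, by nlinarith, fun R hR hRC => ?_⟩
  have hR0 : 0 < R := lt_of_le_of_lt (by positivity) hR
  refine lt_of_le_of_lt (AsyncComm.trainingCapacity_le hK1 hK hq (AsyncComm.sum_outputDist Q P)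
    (AsyncComm.sum_mul_log_le_capacity hreach hP) hR0 hRC) (lt_of_lt_of_le ?_ (hasync R hRC))
  rw [ENNReal.ofReal_lt_ofReal_iff hδ, mul_div_assoc', div_lt_iff₀ hR0]
  rw [mul_div_assoc', div_lt_iff₀ (by positivity)] at hR
  linarith
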